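/- Let $(\Omega,\mathcal F,\mathrm P)$ be a probability space with a filtration $(\mathcal F_t)_{t\ge 0}$, and let $M\ge 2$ (investors) and $N\ge 1$ (assets). Let the payoffs $X_t=(X_t^1,\dots,X_t^N)\in\mathbb R_+^N$, $t\ge1$, be $\mathcal F_t$-measurable and the gross returns of the bank account $\rho_t\ge 0$, $t\ge 1$, be $\mathcal F_{t-1}$-measurable, with $\rho_t+\sum_n X_t^n>0$ a.s. for all $t\ge1$. Let $\Delta=\{\lambda\in\mathbb R_+^{MN}:\sum_n\lambda^{m,n}\le 1\text{ for each }m\}$. A strategy of an investor is a sequence of $\mathcal F_{t-1}\otimes\mathcal B(\mathbb R_+^M\times\Delta^{t-1})$-measurable functions $\Lambda_t(\omega,y_0,\lambda_1,\dots,\lambda_{t-1})$, $t\ge1$, with values in $\{a\in\mathbb R_+^N:\sum_n a^n\le1\}$. Given initial capitals $Y_0\in\mathbb R_+^M$ with $Y_0^k>0$ for all $k$ and a profile $L=(\Lambda^1,\dots,\Lambda^M)$ of strategies, the realizations are $\lambda_t^{m}(\omega)=\Lambda_t^{m}(\omega,Y_0,\lambda_1(\omega),\dots,\lambda_{t-1}(\omega))$,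 where $\lambda_s=(\lambda_s^{m,n})_{m,n}$, and the wealth of investor $m$ is given by \[ Y_t^m=\rho_t\Bigl(1-\sum_n\lambda_t^{m,n}\Bigr)Y_{t-1}^m+\sum_n\frac{\lambda_t^{m,n}Y_{t-1}^m}{\sum_k\lambda_t^{k,n}Y_{t-1}^k}X_t^n,\qquad t\ge1\quad(0/0=0). \] The relative wealth is $r_t^m=Y_t^m/\sum_kY_t^k$ (with $0/0=0$). A strategy $\Lambda^m$ of investor $m$ is relative growth optimal if, for all initial capitals $Y_0$ with $Y_0^k>0$ for all $k$ and all strategies of the other investors, $\ln r_t^m$ is a submartingale (in particular it is a.s. finite and integrable). Let $K_t(\omega,dx)$ be a regular conditional distribution on $\mathbb R_+^N$ of $X_t$ given $\mathcal F_{t-1}$, and $|x|=\sum_n x^n$ for $x\in\mathbb R^N_+$. For $c\ge 0$ let $\zeta_t(\omega,c)$ be the unique root $z\in(0,c]$ of \[ \int_{\mathbb R_+^N}\frac{c\rho_t(\omega)}{z\rho_t(\omega)+|x|}K_t(\omega,dx)=1 \] if $\int_{\mathbb R_+^N} \frac{c\rho_t(\omega)}{|x|}K_t(\omega,dx)>1$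 (with $0/0=0$ and $a/0=+\infty$ for $a>0$), and let $\zeta_t(\omega,c)=0$ otherwise. For a history $\chi_{t-1}=(y_0,\lambda_1,\dots,\lambda_{t-1})$ let $C_{t-1}(\omega,\chi_{t-1})$ be the total wealth at time $t-1$ that the wealth equation yields from the initial capitals $y_0$ and the proportions $\lambda_1,\dots,\lambda_{t-1}$. Define (with $0/0=0$) \[ \hat\Lambda_t^n(\omega,\chi_{t-1})=\int_{\mathbb R_+^N}\frac{x^n}{\zeta_t(\omega,C_{t-1}(\omega,\chi_{t-1}))\rho_t(\omega)+|x|}K_t(\omega,dx). \] Then, for every investor $m$: (1) $\hat\Lambda$ is a strategy, and it is relative growth optimal for investor $m$. (2) Suppose that $\Lambda$ is a strategy of investor $m$ such that, when she uses it, $r_t^m$ is a submartingale for all strictly positive initial capitals and all strategies of the other investors. Then $\hat\Lambda$ and $\Lambda$ are equal in realization until $\tau=\inf\{t\ge0:r_t^m=1\}$ (with $\inf\emptyset=\infty$). That is, for all strictly positive initial capitals $Y_0$ and all strategies of the other investors, if $\hat L$ and $L$ denote the profiles in which investor $m$ uses $\hat\Lambda$ and $\Lambda$, respectively, then almost surely,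 for all $t\ge1$ with $t\le\tau(\omega;Y_0,\hat L)\wedge\tau(\omega;Y_0,L)$, the realizations of the strategy of investor $m$ at time $t$ in the two markets coincide: $\lambda_t^m(\omega;Y_0,\hat L)=\lambda_t^m(\omega;Y_0,L)$. -/

import Mathlib

open MeasureTheory ProbabilityTheory
open scoped NNReal ENNReal

namespace AssetMarketGame

/-- Vectors of investment proportions of one investor: `a n` is the share of the budget put into
asset `n`; the remaining share `1 - ∑ n, a n ≥ 0` goes to the bank account. -/
def Action (N : ℕ) : Type := {a : Fin N → ℝ≥0 // ∑ n, a n ≤ 1}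

instance (N : ℕ) : MeasurableSpace (Action N) :=
  inferInstanceAs (MeasurableSpace {a : Fin N → ℝ≥0 // ∑ n, a n ≤ 1})

/-- The `ℓ¹`-norm of a vector with nonnegative coordinates. -/
def l1 {N : ℕ} (x : Fin N → ℝ≥0) : ℝ≥0 := ∑ n, x n

/-- The history `(λ₁, …, λₜ)` of the proportions chosen by all `M` investors up to time `t`;
`λ_{s+1}` is the entry with index `s`. -/
abbrev Actions (M N t : ℕ) : Type := Fin t → Fin M → Action N

/-- A sequence of functions `(ω, y₀, λ₁, …, λₜ) ↦ Λ_{t+1}(ω, y₀, λ₁, …, λₜ)`, `t = 0, 1, …`;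
so `Λ t` is the decision about the proportions `λ_{t+1}`, taken at time `t`. -/
abbrev Rule (Ω : Type*) (M N : ℕ) : Type _ :=
  (t : ℕ) → Ω → (Fin M → ℝ≥0) → Actions M N t → Action N

/-- A rule is a strategy if `Λ_{t+1}` is jointly measurable, `ω` being taken with the
σ-algebra `ℱ t`. -/
def IsStrategy {Ω : Type*} {m0 : MeasurableSpace Ω} {M N : ℕ} (ℱ : Filtration ℕ m0)
    (Λ : Rule Ω M N) : Prop :=
  ∀ t : ℕ, Measurable[(ℱ t).prod inferInstance]
    (fun p : Ω × ((Fin M → ℝ≥0) × Actions M N t) => Λ t p.1 p.2.1 p.2.2)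

/-- One step of the wealth equation: from wealth vector `y`, proportions `a`, gross return `ρ`
of the bank account and payoffs `x`. The subtraction is a true one, as `∑ n, (a m).1 n ≤ 1`,
and division is with `0 / 0 = 0`. -/
noncomputable def wealthStep {M N : ℕ} (ρ : ℝ≥0) (x : Fin N → ℝ≥0) (a : Fin M → Action N)
    (y : Fin M → ℝ≥0) (m : Fin M) : ℝ≥0 :=
  ρ * (1 - ∑ n, (a m).1 n) * y m
    + ∑ n, ((a m).1 n * y m) / (∑ k, (a k).1 n * y k) * x n

section Model

variable {Ω : Type*} {M N : ℕ} (X : ℕ → Ω → Fin N → ℝ≥0) (ρ : ℕ → Ω → ℝ≥0)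

/-- The wealth vector at time `t` as a function of `ω` and of the history. -/
noncomputable def wealthOf (ω : Ω) (y₀ : Fin M → ℝ≥0) :
    (t : ℕ) → Actions M N t → Fin M → ℝ≥0
  | 0, _ => y₀
  | t + 1, h =>
      wealthStep (ρ (t + 1) ω) (X (t + 1) ω) (h (Fin.last t)) (wealthOf ω y₀ t (Fin.init h))

/-- Total wealth `C_t(ω, y₀, λ₁, …, λₜ)` of all investors as a function of `ω` and of the
history. -/
noncomputable def totalWealthOf (ω : Ω) (y₀ : Fin M → ℝ≥0) (t : ℕ) (h : Actions M N t) : ℝ≥0 :=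
  ∑ m, wealthOf X ρ ω y₀ t h m

/-- The history `(λ₁(ω), …, λₜ(ω))` produced by the strategy profile `L` from the initial
capitals `y₀`. -/
def history (L : Fin M → Rule Ω M N) (y₀ : Fin M → ℝ≥0) (ω : Ω) : (t : ℕ) → Actions M N t
  | 0 => Fin.elim0
  | t + 1 => Fin.snoc (history L y₀ ω t) (fun m => L m t ω y₀ (history L y₀ ω t))

/-- The realization `λ_{t+1}^m(ω; y₀, L)` of the strategy of investor `m`. -/
def realization (L : Fin M → Rule Ω M N) (y₀ : Fin M → ℝ≥0) (m : Fin M) (t : ℕ) (ω : Ω) :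
    Action N :=
  L m t ω y₀ (history L y₀ ω t)

/-- The wealth `Y_t^m(ω)`. -/
noncomputable def wealth (L : Fin M → Rule Ω M N) (y₀ : Fin M → ℝ≥0) (m : Fin M) (t : ℕ)
    (ω : Ω) : ℝ≥0 :=
  wealthOf X ρ ω y₀ t (history L y₀ ω t) m

/-- The relative wealth `r_t^m(ω) = Y_t^m / ∑ k, Y_t^k`, with `0 / 0 = 0`. -/
noncomputable def relWealth (L : Fin M → Rule Ω M N) (y₀ : Fin M → ℝ≥0) (m : Fin M) (t : ℕ)
    (ω : Ω) : ℝ :=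
  (wealth X ρ L y₀ m t ω : ℝ) / ∑ k, (wealth X ρ L y₀ k t ω : ℝ)

/-- The first time `inf {t ≥ 0 : r_t^m = 1}`, which is `⊤` if there is no such `t`. -/
noncomputable def hitOne (m : Fin M) (y₀ : Fin M → ℝ≥0) (L : Fin M → Rule Ω M N) (ω : Ω) : ℕ∞ :=
  ⨅ (t : ℕ) (_ : relWealth X ρ L y₀ m t ω = 1), (t : ℕ∞)

variable {m0 : MeasurableSpace Ω} (μ : Measure Ω) (ℱ : Filtration ℕ m0)

/-- `ln r_t^m` is a submartingale for all positive initial capitals and all strategies of the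
others, when investor `m` uses `Λ`. As `Real.log 0 = 0`, the requirement that `ln r_t^m` be
a.s. finite is stated explicitly. -/
def IsRelativeGrowthOptimal (m : Fin M) (Λ : Rule Ω M N) : Prop :=
  ∀ y₀ : Fin M → ℝ≥0, (∀ k, 0 < y₀ k) →
    ∀ L : Fin M → Rule Ω M N, (∀ k, k ≠ m → IsStrategy ℱ (L k)) →
      (∀ t, ∀ᵐ ω ∂μ, 0 < relWealth X ρ (Function.update L m Λ) y₀ m t ω) ∧
      Submartingale
        (fun t ω => Real.log (relWealth X ρ (Function.update L m Λ) y₀ m t ω)) ℱ μ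

/-- `r_t^m` is a submartingale for all positive initial capitals and all strategies of the
others, when investor `m` uses `Λ`. -/
def RelWealthSubmartingale (m : Fin M) (Λ : Rule Ω M N) : Prop :=
  ∀ y₀ : Fin M → ℝ≥0, (∀ k, 0 < y₀ k) →
    ∀ L : Fin M → Rule Ω M N, (∀ k, k ≠ m → IsStrategy ℱ (L k)) →
      Submartingale (relWealth X ρ (Function.update L m Λ) y₀ m) ℱ μ

/-- Strategies `Λ`, `Λ'` of investor `m` are equal in realization until `τ`: whatever the initial
capitals and the strategies of the others are, a.s. for every `t ≥ 0`, the realizations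
`λ_{t+1}^m` agree if `t + 1` does not exceed `τ` in either of the two markets. -/
def EqualInRealizationUntil (m : Fin M) (Λ Λ' : Rule Ω M N)
    (τ : (Fin M → ℝ≥0) → (Fin M → Rule Ω M N) → Ω → ℕ∞) : Prop :=
  ∀ y₀ : Fin M → ℝ≥0, (∀ k, 0 < y₀ k) →
    ∀ L : Fin M → Rule Ω M N, (∀ k, k ≠ m → IsStrategy ℱ (L k)) →
      ∀ᵐ ω ∂μ, ∀ t : ℕ,
        ((t + 1 : ℕ) : ℕ∞) ≤
            min (τ y₀ (Function.update L m Λ) ω) (τ y₀ (Function.update L m Λ') ω) →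
          realization (Function.update L m Λ) y₀ m t ω
            = realization (Function.update L m Λ') y₀ m t ω

/-- `K t` is a regular conditional distribution of the payoff vector `X_{t+1}` given `ℱ t`
(measurability in `ω` with respect to `ℱ t` is part of the type of `K t`). -/
def IsRegularCondDistrib (K : (t : ℕ) → @Kernel Ω (Fin N → ℝ≥0) (ℱ t) _) : Prop :=
  ∀ (t : ℕ) (A : Set (Fin N → ℝ≥0)), MeasurableSet A →
    (fun ω => (K t ω).real A) =ᵐ[μ] μ⟦X (t + 1) ⁻¹' A | ℱ t⟧

/-- Regular conditional distributions of the payoffs exist, for every filtration. -/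
theorem exists_regularCondDistrib [IsProbabilityMeasure μ]
    (hX : ∀ t : ℕ, Measurable[ℱ (t + 1)] (X (t + 1))) :
    ∃ K : (t : ℕ) → @Kernel Ω (Fin N → ℝ≥0) (ℱ t) _,
      (∀ t, IsMarkovKernel (K t)) ∧ IsRegularCondDistrib X μ ℱ K := by
  refine ⟨fun t => @condDistrib Ω Ω (Fin N → ℝ≥0) _ _ _ m0 (ℱ t) (X (t + 1)) id μ _,
    fun t => inferInstance, ?_⟩
  intro t A hA
  have := condDistrib_ae_eq_condExp (mβ := ℱ t) (X := id) (Y := X (t + 1)) (μ := μ)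
     (measurable_id'' (ℱ.le t)) ((hX t).mono (ℱ.le _) le_rfl) hA
  rw [MeasurableSpace.comap_id] at this
  exact this

end Model

section Root

variable {N : ℕ} (κ : Measure (Fin N → ℝ≥0)) [IsProbabilityMeasure κ] (ρ c : ℝ≥0)

/-- The section of the set `Γ_t`, i.e. `∫ c ρ / |x| κ(dx) > 1`. Division in `ℝ≥0∞` has
`0 / 0 = 0` and `a / 0 = ∞` for `a > 0`. -/
def InGamma : Prop :=
  1 < ∫⁻ x : Fin N → ℝ≥0, ((c * ρ : ℝ≥0) : ℝ≥0∞) / (l1 x : ℝ≥0∞) ∂κ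

/-- `z ∈ (0, c]` solves `∫ c ρ / (z ρ + |x|) κ(dx) = 1`. -/
def IsRoot (z : ℝ≥0) : Prop :=
  0 < z ∧ z ≤ c ∧
    ∫⁻ x : Fin N → ℝ≥0, ((c * ρ : ℝ≥0) : ℝ≥0∞) / ((z * ρ + l1 x : ℝ≥0) : ℝ≥0∞) ∂κ = 1

theorem measurable_l1 : Measurable (l1 : (Fin N → ℝ≥0) → ℝ≥0) := by
  unfold l1; fun_prop

theorem existsUnique_root (h : InGamma κ ρ c) : ∃! z, IsRoot κ ρ c z := by
  have hml : Measurable (l1 : (Fin N → ℝ≥0) → ℝ≥0) := measurable_l1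
  set g : ℝ≥0 → (Fin N → ℝ≥0) → ℝ≥0∞ := fun z x =>
    ((c * ρ : ℝ≥0) : ℝ≥0∞) / ((z * ρ + l1 x : ℝ≥0) : ℝ≥0∞) with hg
  have hgm : ∀ z, Measurable (g z) := fun z => by
    simp only [hg]; fun_prop
  have hcρ : 0 < c * ρ := by
    by_contra h0
    have h0' : c * ρ = 0 := le_antisymm (not_lt.mp h0) zero_le
    simp [InGamma, h0'] at h
  have hρ : 0 < ρ := pos_of_mul_pos_right hcρ zero_le
  have hc : 0 < c := pos_of_mul_pos_left hcρ zero_le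
  have hanti : ∀ z z' x, z ≤ z' → g z' x ≤ g z x := fun z z' x hz => by
    simp only [hg]; gcongr
  have hcont : ∀ x, Continuous (fun z => g z x) := fun x => by
    simp only [hg, div_eq_mul_inv]
    refine ENNReal.continuous_const_mul ENNReal.coe_ne_top |>.comp ?_
    refine continuous_inv.comp ?_
    exact ENNReal.continuous_coe.comp (by fun_prop)
  have h0 : 1 < ∫⁻ x, g 0 x ∂κ := by simpa [InGamma, hg] using h
  have hbound : ∀ z x, 0 < z → g z x ≤ ((c * ρ : ℝ≥0) : ℝ≥0∞) / ((z * ρ : ℝ≥0) : ℝ≥0∞) := by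
    intro z x hz
    simp only [hg]
    gcongr
    exact le_self_add
  have hfin : ∀ z, 0 < z → ((c * ρ : ℝ≥0) : ℝ≥0∞) / ((z * ρ : ℝ≥0) : ℝ≥0∞) ≠ ∞ := by
    intro z hz
    exact ENNReal.div_ne_top ENNReal.coe_ne_top (by exact_mod_cast (mul_pos hz hρ).ne')
  have hcle : ∫⁻ x, g c x ∂κ ≤ 1 := by
    calc ∫⁻ x, g c x ∂κ ≤ ∫⁻ _, 1 ∂κ := by
          refine lintegral_mono fun x => ?_
          refine (hbound c x hc).trans ?_
          rw [ENNReal.div_self] <;> simp [hc.ne', hρ.ne', ENNReal.mul_eq_top]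
      _ = 1 := by simp
  obtain ⟨z₀, hz₀, hz₀1⟩ : ∃ z₀ : ℝ≥0, 0 < z₀ ∧ 1 < ∫⁻ x, g z₀ x ∂κ := by
    have ht : Filter.Tendsto (fun k : ℕ => ∫⁻ x, g (1 / ((k : ℝ≥0) + 1)) x ∂κ) Filter.atTop
        (nhds (∫⁻ x, g 0 x ∂κ)) := by
      refine lintegral_tendsto_of_tendsto_of_monotone (fun k => (hgm _).aemeasurable) ?_ ?_
      · refine Filter.Eventually.of_forall fun x k k' hk => hanti _ _ x ?_
        gcongr
      · refine Filter.Eventually.of_forall fun x => ?_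
        exact ((hcont x).tendsto 0).comp tendsto_one_div_add_atTop_nhds_zero_nat
    obtain ⟨k, hk⟩ := (ht.eventually_const_lt h0).exists
    exact ⟨_, by positivity, hk⟩
  have hz₀c : z₀ ≤ c := by
    by_contra hlt
    have := lintegral_mono (μ := κ) (fun x => hanti c z₀ x (not_le.mp hlt).le)
    exact absurd (hz₀1.trans_le (this.trans hcle)) (lt_irrefl _)
  have hcontI : ContinuousOn (fun z => ∫⁻ x, g z x ∂κ) (Set.Icc z₀ c) := by
    intro z _
    refine tendsto_lintegral_filter_of_dominated_convergence
      (fun _ => ((c * ρ : ℝ≥0) : ℝ≥0∞) / ((z₀ * ρ : ℝ≥0) : ℝ≥0∞)) ?_ ?_ ?_ ?_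
    · exact Filter.Eventually.of_forall fun z => (hgm z)
    · filter_upwards [self_mem_nhdsWithin] with z' hz'
      exact Filter.Eventually.of_forall fun x => (hanti _ _ x hz'.1).trans (hbound z₀ x hz₀)
    · simpa using hfin z₀ hz₀
    · exact Filter.Eventually.of_forall fun x => ((hcont x).tendsto z).mono_left nhdsWithin_le_nhds
  obtain ⟨z, hz, hz1⟩ := intermediate_value_Icc' hz₀c hcontI ⟨hcle, hz₀1.le⟩
  have hstrict : ∀ a b : ℝ≥0, 0 < a → a < b → ∫⁻ x, g b x ∂κ = 1 → ∫⁻ x, g a x ∂κ = 1 → False := by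
    intro a b ha hab hb1 ha1
    have := lintegral_strict_mono (μ := κ) (f := g b) (g := g a) (IsProbabilityMeasure.ne_zero κ)
      (hgm a).aemeasurable (by simp [hb1]) (Filter.Eventually.of_forall fun x => by
        simp only [hg]
        refine ENNReal.div_lt_div_left (by exact_mod_cast hcρ.ne') ENNReal.coe_ne_top ?_
        exact_mod_cast add_lt_add_left (mul_lt_mul_of_pos_right hab hρ) _)
    simp [ha1, hb1] at this
  refine ⟨z, ⟨hz₀.trans_le hz.1, hz.2, hz1⟩, fun w hw => ?_⟩
  rcases lt_trichotomy w z with hlt | heq | hlt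
  · exact (hstrict w z hw.1 hlt hz1 hw.2.2).elim
  · exact heq
  · exact (hstrict z w (hz₀.trans_le hz.1) hlt hw.2.2 hz1).elim

open Classical in
/-- `ζ`: the unique root on `Γ_t`, and `0` outside. -/
noncomputable def zeta : ℝ≥0 :=
  if h : InGamma κ ρ c then (existsUnique_root κ ρ c h).choose else 0

/-- `∫ xⁿ / (ζ ρ + |x|) κ(dx)`, with `0 / 0 = 0`; the integrand is at most `1`. -/
noncomputable def optimalShare (n : Fin N) : ℝ≥0 :=
  (∫⁻ x : Fin N → ℝ≥0, ((x n / (zeta κ ρ c * ρ + l1 x) : ℝ≥0) : ℝ≥0∞) ∂κ).toNNReal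

theorem sum_optimalShare_le : ∑ n, optimalShare κ ρ c n ≤ 1 := by
  have hml : Measurable (l1 : (Fin N → ℝ≥0) → ℝ≥0) := measurable_l1
  have hsum : ∑ n, ∫⁻ x : Fin N → ℝ≥0, ((x n / (zeta κ ρ c * ρ + l1 x) : ℝ≥0) : ℝ≥0∞) ∂κ ≤ 1 := by
    rw [← lintegral_finsetSum' _ (fun n _ => by fun_prop)]
    calc _ ≤ ∫⁻ _, 1 ∂κ := by
          refine lintegral_mono fun x => ?_
          rw [← ENNReal.ofNNReal_finsetSum]
          have : ∑ n, x n / (zeta κ ρ c * ρ + l1 x) ≤ 1 := by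
            rw [← Finset.sum_div]
            exact div_le_one_of_le₀ le_add_self zero_le
          exact ENNReal.coe_le_one_iff.mpr this
      _ = 1 := by simp
  have hne : ∀ n ∈ Finset.univ,
      ∫⁻ x : Fin N → ℝ≥0, ((x n / (zeta κ ρ c * ρ + l1 x) : ℝ≥0) : ℝ≥0∞) ∂κ ≠ ∞ := fun n hn =>
    ne_top_of_le_ne_top ENNReal.one_ne_top
      ((Finset.single_le_sum (fun _ _ => zero_le) hn).trans hsum)
  unfold optimalShare
  rw [← ENNReal.toNNReal_sum hne]
  exact ENNReal.toNNReal_mono ENNReal.one_ne_top hsum |>.trans (by simp)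

end Root

/-- The strategy `Λ̂`: `Λ̂_{t+1}^n(ω, χ_t) = ∫ xⁿ / (ζ_{t+1}(ω, C_t(ω, χ_t)) ρ_{t+1}(ω) + |x|)
K_{t+1}(ω, dx)`, where `K t` stands for `K_{t+1}`. -/
noncomputable def optimalRule {Ω : Type*} {m0 : MeasurableSpace Ω} {M N : ℕ}
    (X : ℕ → Ω → Fin N → ℝ≥0) (ρ : ℕ → Ω → ℝ≥0) (ℱ : Filtration ℕ m0)
    (K : (t : ℕ) → @Kernel Ω (Fin N → ℝ≥0) (ℱ t) _) [∀ t, IsMarkovKernel (K t)] :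
    Rule Ω M N :=
  fun t ω y₀ h =>
    ⟨optimalShare (K t ω) (ρ (t + 1) ω) (totalWealthOf X ρ ω y₀ t h),
      sum_optimalShare_le _ _ _⟩

end AssetMarketGame

open AssetMarketGame

/-! Fix a time and a state. Let `c` be the total wealth, `z` the root, `l` the optimal portfolio,
`b` the wealth-weighted average portfolio of the market, and `d = z * ρ + |x|`. By construction `l
n` is the mean of `x n / d`, and the equation for `z` makes the bank share `1 - ∑ l n` equal to `z /
c`.

An investor using `l` multiplies her capital by `s * d / c`, where `s` is the mean of the numbers
`1` and `l n / b n` with weights `z * ρ / d` and `x n / d`. Jensen's inequality bounds `log s` below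
by a variable with mean `∑ l n * log (l n / b n)`. The new total wealth `W` is at most `c * ρ * (1 -
∑ b n) + |x|`, and `log (W / d) ≤ W / d - 1` has a bound of mean at most `∑ l n - ∑ b n`. So the
expected logarithmic growth relative to the market is at least `∑ (l n * log (l n / b n) - l n + b
n)`, which is nonnegative by Gibbs' inequality and positive unless `b = l`. This is
`exists_minorant`; `coalition_minorant` states it for a group of investors who all use `l`.

The group `{m}` gives the submartingale property of `log r`, once `setLIntegral_eq_of_condDistrib`
has reduced conditional expectations to integrals against the kernel. For uniqueness, the group
consists of all investors but `m`: their expected share strictly increases unless the market as a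
whole, and hence `m`, invests optimally (`ae_realization_eq_of_submartingale`). The opponents may be
assumed to switch to the optimal rule at any given time, which leaves the earlier history unchanged,
so induction on time determines the decisions of `m` (`ae_history_eq`). -/

namespace AssetMarketGame

/-! ### The root `ζ` and the optimal portfolio for a fixed law of payoffs -/

section Root

variable {N : ℕ} (κ : Measure (Fin N → ℝ≥0)) [IsProbabilityMeasure κ] (ρ c : ℝ≥0)

theorem isRoot_zeta (h : InGamma κ ρ c) : IsRoot κ ρ c (zeta κ ρ c) := by
  rw [zeta, dif_pos h]
  exact (existsUnique_root κ ρ c h).choose_spec.1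

theorem zeta_eq_zero (h : ¬ InGamma κ ρ c) : zeta κ ρ c = 0 := dif_neg h

theorem mul_pos_of_inGamma (h : InGamma κ ρ c) : 0 < c * ρ := by
  by_contra h0
  have h0' : c * ρ = 0 := le_antisymm (not_lt.mp h0) zero_le
  simp [InGamma, h0'] at h

/-- The integral is strictly decreasing in `b` on `Γ`; off `Γ` both sides fail. This describes the
superlevel sets of `ζ` without the root, which gives measurability, and taking `b = ζ` shows that
the integral at `ζ` is at most `1` in all cases. -/
theorem lt_zeta_iff (b : ℝ≥0) : b < zeta κ ρ c ↔
    1 < ∫⁻ x : Fin N → ℝ≥0, ((c * ρ : ℝ≥0) : ℝ≥0∞) / ((b * ρ + l1 x : ℝ≥0) : ℝ≥0∞) ∂κ := by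
  have hml : Measurable (l1 : (Fin N → ℝ≥0) → ℝ≥0) := measurable_l1
  constructor
  · intro hb
    have hG : InGamma κ ρ c := by
      by_contra hG
      simp [zeta_eq_zero κ ρ c hG] at hb
    have hcρ := mul_pos_of_inGamma κ ρ c hG
    have hρ : 0 < ρ := pos_of_mul_pos_right hcρ zero_le
    have hr := (isRoot_zeta κ ρ c hG).2.2
    rw [← hr]
    refine lintegral_strict_mono (IsProbabilityMeasure.ne_zero κ) (by fun_prop)
      (by rw [hr]; exact ENNReal.one_ne_top)
      (Filter.Eventually.of_forall fun x => ?_)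
    refine ENNReal.div_lt_div_left (by exact_mod_cast hcρ.ne') ENNReal.coe_ne_top ?_
    exact_mod_cast add_lt_add_left (mul_lt_mul_of_pos_right hb hρ) _
  · intro hb
    have hG : InGamma κ ρ c := by
      refine hb.trans_le (lintegral_mono fun x => ?_)
      gcongr
      exact le_add_self
    by_contra hz
    have hr := (isRoot_zeta κ ρ c hG).2.2
    refine absurd (hr ▸ hb) (not_lt.mpr (lintegral_mono fun x => ?_))
    have := not_lt.mp hz
    gcongr

/-- Almost surely the denominator in the definition of the optimal share does not vanish. -/
theorem ae_zeta_mul_add_pos (hc : 0 < c) (hae : ∀ᵐ x ∂κ, 0 < ρ + l1 x) :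
    ∀ᵐ x ∂κ, 0 < zeta κ ρ c * ρ + l1 x := by
  have hml : Measurable (l1 : (Fin N → ℝ≥0) → ℝ≥0) := measurable_l1
  by_cases hG : InGamma κ ρ c
  · have hcρ := mul_pos_of_inGamma κ ρ c hG
    have hρ : 0 < ρ := pos_of_mul_pos_right hcρ zero_le
    have := (isRoot_zeta κ ρ c hG).1
    exact Filter.Eventually.of_forall fun x => by positivity
  -- Off `Γ` the integrand is a.e. finite, whereas it would be infinite where `l1 x = 0` and `ρ >
  -- 0`.
  · have hle : ∫⁻ x : Fin N → ℝ≥0, ((c * ρ : ℝ≥0) : ℝ≥0∞) / (l1 x : ℝ≥0∞) ∂κ ≤ 1 := not_lt.mp hG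
    have hfin := ae_lt_top' (μ := κ)
      (f := fun x : Fin N → ℝ≥0 => ((c * ρ : ℝ≥0) : ℝ≥0∞) / (l1 x : ℝ≥0∞)) (by fun_prop)
      (ne_top_of_le_ne_top ENNReal.one_ne_top hle)
    filter_upwards [hfin, hae] with x hx hx'
    rw [zeta_eq_zero κ ρ c hG, zero_mul, zero_add]
    by_contra h0
    have h0' : l1 x = 0 := le_antisymm (not_lt.mp h0) zero_le
    rw [h0', add_zero] at hx'
    rw [h0', ENNReal.coe_zero, ENNReal.div_zero] at hx
    · exact lt_irrefl _ hx
    · exact_mod_cast (mul_pos hc hx').ne'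

/-- The defining equation of the root, in real terms: the integral is at most `1`, with equality
unless the root vanishes. -/
theorem zeta_integral (hc : 0 < c) (hae : ∀ᵐ x ∂κ, 0 < ρ + l1 x) :
    Integrable (fun x : Fin N → ℝ≥0 => (c * ρ / (zeta κ ρ c * ρ + l1 x) : ℝ)) κ ∧
    ∫ x : Fin N → ℝ≥0, (c * ρ / (zeta κ ρ c * ρ + l1 x) : ℝ) ∂κ ≤ 1 ∧
    zeta κ ρ c * ∫ x : Fin N → ℝ≥0, (c * ρ / (zeta κ ρ c * ρ + l1 x) : ℝ) ∂κ = zeta κ ρ c := by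
  have hml : Measurable (l1 : (Fin N → ℝ≥0) → ℝ≥0) := measurable_l1
  set z := zeta κ ρ c with hz
  have hmeas : Measurable (fun x : Fin N → ℝ≥0 => (c * ρ / (z * ρ + l1 x) : ℝ)) := by fun_prop
  have hnn : ∀ x : Fin N → ℝ≥0, 0 ≤ (c * ρ / (z * ρ + l1 x) : ℝ) := fun x => by positivity
  have hlin : ∫⁻ x : Fin N → ℝ≥0, ENNReal.ofReal (c * ρ / (z * ρ + l1 x) : ℝ) ∂κ =
      ∫⁻ x : Fin N → ℝ≥0, ((c * ρ : ℝ≥0) : ℝ≥0∞) / ((z * ρ + l1 x : ℝ≥0) : ℝ≥0∞) ∂κ := by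
    -- Division by zero differs in `ℝ` and `ℝ≥0∞`, so the integrands agree only where the
    -- denominator is positive.
    refine lintegral_congr_ae ?_
    filter_upwards [ae_zeta_mul_add_pos κ ρ c hc hae] with x hx
    rw [← ENNReal.coe_div hx.ne', ← ENNReal.ofReal_coe_nnreal]
    push_cast
    rfl
  have hle : ∫⁻ x : Fin N → ℝ≥0, ((c * ρ : ℝ≥0) : ℝ≥0∞) / ((z * ρ + l1 x : ℝ≥0) : ℝ≥0∞) ∂κ ≤ 1 :=
    not_lt.mp fun h => lt_irrefl _ ((lt_zeta_iff κ ρ c z).mpr h)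
  have hint : Integrable (fun x : Fin N → ℝ≥0 => (c * ρ / (z * ρ + l1 x) : ℝ)) κ := by
    refine ⟨hmeas.aestronglyMeasurable, ?_⟩
    rw [hasFiniteIntegral_iff_ofReal (Filter.Eventually.of_forall hnn), hlin]
    exact hle.trans_lt ENNReal.one_lt_top
  have heq := integral_eq_lintegral_of_nonneg_ae (μ := κ) (Filter.Eventually.of_forall hnn)
    hmeas.aestronglyMeasurable
  refine ⟨hint, ?_, ?_⟩
  · rw [heq, hlin]
    exact ENNReal.toReal_le_of_le_ofReal zero_le_one (by simpa using hle)
  · by_cases hG : InGamma κ ρ c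
    · rw [heq, hlin, (isRoot_zeta κ ρ c hG).2.2]
      simp
    · rw [hz, zeta_eq_zero κ ρ c hG]
      simp

theorem integrable_share (n : Fin N) :
    Integrable (fun x : Fin N → ℝ≥0 => (x n / (zeta κ ρ c * ρ + l1 x) : ℝ)) κ := by
  have hml : Measurable (l1 : (Fin N → ℝ≥0) → ℝ≥0) := measurable_l1
  refine Integrable.of_bound (by fun_prop : Measurable _).aestronglyMeasurable 1
    (Filter.Eventually.of_forall fun x => ?_)
  rw [Real.norm_of_nonneg (by positivity)]
  refine div_le_one_of_le₀ ?_ (by positivity)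
  have : x n ≤ zeta κ ρ c * ρ + l1 x :=
    (Finset.single_le_sum (fun _ _ => zero_le) (Finset.mem_univ n)).trans le_add_self
  exact_mod_cast this

theorem optimalShare_eq_integral (n : Fin N) : (optimalShare κ ρ c n : ℝ) =
    ∫ x : Fin N → ℝ≥0, (x n / (zeta κ ρ c * ρ + l1 x) : ℝ) ∂κ := by
  rw [integral_eq_lintegral_of_nonneg_ae (Filter.Eventually.of_forall fun x => by positivity)
    (integrable_share κ ρ c n).1]
  change ENNReal.toReal _ = _
  congr 1
  refine lintegral_congr fun x => ?_
  rw [← ENNReal.ofReal_coe_nnreal]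
  push_cast
  rfl

/-- The share `1 - ∑ n, λ̂ n` that goes to the bank account is `ζ / c`. -/
theorem mul_sum_optimalShare_add_zeta (hc : 0 < c) (hae : ∀ᵐ x ∂κ, 0 < ρ + l1 x) :
    (c : ℝ) * ∑ n, (optimalShare κ ρ c n : ℝ) + zeta κ ρ c = c := by
  obtain ⟨hint, -, hz⟩ := zeta_integral κ ρ c hc hae
  -- The identity `c * |x| / d + ζ * (c * ρ / d) = c` is integrated; the second term contributes
  -- `ζ`, whether or not `ζ` vanishes.
  have h1 : ∫ x : Fin N → ℝ≥0, ((c : ℝ) * ∑ n, (x n / (zeta κ ρ c * ρ + l1 x) : ℝ) +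
      zeta κ ρ c * (c * ρ / (zeta κ ρ c * ρ + l1 x) : ℝ)) ∂κ = ∫ _, (c : ℝ) ∂κ := by
    refine integral_congr_ae ?_
    filter_upwards [ae_zeta_mul_add_pos κ ρ c hc hae] with x hx
    have hx' : (0 : ℝ) < zeta κ ρ c * ρ + l1 x := by exact_mod_cast hx
    have hs : ∑ n, (x n : ℝ) = l1 x := by simp [l1]
    rw [← Finset.sum_div, hs]
    field_simp
    ring
  rw [integral_add ((integrable_finsetSum _ fun n _ => integrable_share κ ρ c n).const_mul _)
    (hint.const_mul _), integral_const_mul, integral_const_mul, hz,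
    integral_finsetSum _ fun n _ => integrable_share κ ρ c n] at h1
  simpa [optimalShare_eq_integral] using h1

/-- A nonnegative integrand with zero integral vanishes a.e.; since `x n` is at most the
denominator, a zero denominator also forces `x n = 0`. -/
theorem ae_eq_zero_of_optimalShare_eq_zero (n : Fin N) (h : optimalShare κ ρ c n = 0) :
    ∀ᵐ x ∂κ, x n = 0 := by
  have h' : ∫ x : Fin N → ℝ≥0, (x n / (zeta κ ρ c * ρ + l1 x) : ℝ) ∂κ = 0 := by
    rw [← optimalShare_eq_integral, h, NNReal.coe_zero]
  rw [integral_eq_zero_iff_of_nonneg (fun x => by positivity) (integrable_share κ ρ c n)] at h'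
  filter_upwards [h'] with x hx
  have hle : x n ≤ zeta κ ρ c * ρ + l1 x :=
    (Finset.single_le_sum (fun _ _ => zero_le) (Finset.mem_univ n)).trans le_add_self
  rcases div_eq_zero_iff.mp hx with h0 | h0
  · exact_mod_cast h0
  · have : zeta κ ρ c * ρ + l1 x = 0 := by exact_mod_cast h0
    exact le_antisymm (this ▸ hle) zero_le

end Root

/-! ### Measurable dependence of the root and the portfolio on parameters -/

section RootMeasurable

variable {α : Type*} [MeasurableSpace α] {N : ℕ} (κ : Kernel α (Fin N → ℝ≥0)) [IsMarkovKernel κ]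
  {ρ c : α → ℝ≥0}

theorem measurable_zeta (hρ : Measurable ρ) (hc : Measurable c) :
    Measurable fun a => zeta (κ a) (ρ a) (c a) := by
  have hml : Measurable (l1 : (Fin N → ℝ≥0) → ℝ≥0) := measurable_l1
  refine measurable_of_Ioi fun b => ?_
  have : (fun a => zeta (κ a) (ρ a) (c a)) ⁻¹' Set.Ioi b = {a | 1 < ∫⁻ x : Fin N → ℝ≥0,
      ((c a * ρ a : ℝ≥0) : ℝ≥0∞) / ((b * ρ a + l1 x : ℝ≥0) : ℝ≥0∞) ∂(κ a)} := by
    ext a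
    exact lt_zeta_iff (κ a) (ρ a) (c a) b
  rw [this]
  refine measurableSet_lt measurable_const (Measurable.lintegral_kernel_prod_right ?_)
  unfold Function.uncurry
  fun_prop

theorem measurable_optimalShare (hρ : Measurable ρ) (hc : Measurable c) (n : Fin N) :
    Measurable fun a => optimalShare (κ a) (ρ a) (c a) n := by
  have hml : Measurable (l1 : (Fin N → ℝ≥0) → ℝ≥0) := measurable_l1
  have hz : Measurable fun p : α × (Fin N → ℝ≥0) => zeta (κ p.1) (ρ p.1) (c p.1) :=
    (measurable_zeta κ hρ hc).comp measurable_fst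
  refine Measurable.ennreal_toNNReal (Measurable.lintegral_kernel_prod_right ?_)
  unfold Function.uncurry
  fun_prop

end RootMeasurable

/-! ### Gibbs' and Jensen's inequalities -/

section RelativeEntropy

/-- `a log (a / b) - a + b`, the contribution of one asset to the relative entropy. The factor
`a / b` may be replaced by any `u` with `a = u * b` when `a ≠ 0`. -/
theorem entropy_nonneg {a b u : ℝ} (ha : 0 ≤ a) (hb : 0 ≤ b)
    (hu : a ≠ 0 → 0 < b ∧ u = a / b) : 0 ≤ a * Real.log u - a + b := by
  rcases ha.eq_or_lt with h | h
  · rw [← h]; simpa using hb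
  · obtain ⟨hb', rfl⟩ := hu h.ne'
    have := Real.log_le_sub_one_of_pos (div_pos hb' h)
    rw [← inv_div, Real.log_inv] at this
    have h2 := mul_le_mul_of_nonneg_left this ha
    have h3 : a * ((a / b)⁻¹ - 1) = b - a := by field_simp
    linarith

theorem entropy_pos {a b u : ℝ} (ha : 0 ≤ a) (hb : 0 ≤ b)
    (hu : a ≠ 0 → 0 < b ∧ u = a / b) (hab : b ≠ a) : 0 < a * Real.log u - a + b := by
  rcases ha.eq_or_lt with h | h
  · rw [← h] at hab ⊢; simpa using lt_of_le_of_ne hb hab.symm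
  · obtain ⟨hb', rfl⟩ := hu h.ne'
    have := Real.log_lt_sub_one_of_pos (div_pos hb' h)
      (fun h1 => hab ((div_eq_one_iff_eq h.ne').mp h1))
    rw [← inv_div, Real.log_inv] at this
    have h2 := mul_lt_mul_of_pos_left this h
    have h3 : a * ((a / b)⁻¹ - 1) = b - a := by field_simp
    linarith

/-- Jensen's inequality for the logarithm, with one of the points equal to `1`. -/
theorem sum_mul_log_le_log {ι : Type*} [Fintype ι] {p₀ : ℝ} {p u : ι → ℝ} (hp₀ : 0 ≤ p₀)
    (hp : ∀ i, 0 ≤ p i) (hsum : p₀ + ∑ i, p i = 1) (hu : ∀ i, 0 < u i) :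
    0 < p₀ + ∑ i, p i * u i ∧ ∑ i, p i * Real.log (u i) ≤ Real.log (p₀ + ∑ i, p i * u i) := by
  have hnn : ∀ i, 0 ≤ p i * u i := fun i => mul_nonneg (hp i) (hu i).le
  have hs : 0 < p₀ + ∑ i, p i * u i := by
    refine lt_of_le_of_ne (add_nonneg hp₀ (Finset.sum_nonneg fun i _ => hnn i)) fun h => ?_
    have h0 : p₀ = 0 := by linarith [Finset.sum_nonneg fun i (_ : i ∈ Finset.univ) => hnn i]
    have h1 : ∑ i, p i * u i = 0 := by linarith
    rw [Finset.sum_eq_zero_iff_of_nonneg fun i _ => hnn i] at h1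
    have h2 : ∑ i, p i = 0 := Finset.sum_eq_zero fun i hi =>
      (mul_eq_zero.mp (h1 i hi)).resolve_right (hu i).ne'
    linarith
  refine ⟨hs, ?_⟩
  set s := p₀ + ∑ i, p i * u i with hsdef
  -- Tangent line of `log` at the mean `s`; after summation with `h2` the right-hand sides cancel.
  have h1 : ∀ i, p i * (Real.log (u i) - Real.log s) ≤ p i * u i / s - p i := fun i => by
    have := Real.log_le_sub_one_of_pos (div_pos (hu i) hs)
    rw [Real.log_div (hu i).ne' hs.ne'] at this
    calc _ ≤ p i * (u i / s - 1) := mul_le_mul_of_nonneg_left this (hp i)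
      _ = _ := by ring
  have h2 : p₀ * (0 - Real.log s) ≤ p₀ / s - p₀ := by
    have := Real.log_le_sub_one_of_pos (div_pos one_pos hs)
    rw [Real.log_div one_ne_zero hs.ne', Real.log_one] at this
    calc _ ≤ p₀ * (1 / s - 1) := mul_le_mul_of_nonneg_left this hp₀
      _ = _ := by ring
  have h3 := Finset.sum_le_sum fun i (_ : i ∈ Finset.univ) => h1 i
  simp only [mul_sub, Finset.sum_sub_distrib, ← Finset.sum_mul, ← Finset.sum_div] at h3
  have h4 : (p₀ + ∑ i, p i * u i) / s = 1 := div_self hs.ne'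
  rw [add_div] at h4
  have h5 : (p₀ + ∑ i, p i) * Real.log s = Real.log s := by rw [hsum, one_mul]
  linarith

end RelativeEntropy

/-! ### Logarithmic growth of the optimal portfolio relative to the market -/

section Growth

variable {N : ℕ} (κ : Measure (Fin N → ℝ≥0)) [IsProbabilityMeasure κ] (ρ c : ℝ≥0)

/-- The growth inequality: if the market invests the proportions `b` on average, then the logarithm
of the growth rate of the optimal portfolio relative to the market has an integrable minorant whose
integral is nonnegative, and is positive unless `b` is the optimal portfolio. -/
theorem exists_minorant (hc : 0 < c) (hae : ∀ᵐ x ∂κ, 0 < ρ + l1 x) (b : Fin N → ℝ)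
    (hb0 : ∀ n, 0 ≤ b n) (hb1 : ∑ n, b n ≤ 1) (hb : ∀ n, optimalShare κ ρ c n ≠ 0 → 0 < b n) :
    ∃ H : (Fin N → ℝ≥0) → ℝ, Integrable H κ ∧ 0 ≤ ∫ x, H x ∂κ ∧
      ((∃ n, b n ≠ optimalShare κ ρ c n) → 0 < ∫ x, H x ∂κ) ∧
      ∀ᵐ x ∂κ, 0 < (zeta κ ρ c * ρ + ∑ n, optimalShare κ ρ c n / b n * x n : ℝ) ∧
        ∀ W : ℝ, 0 < W → W ≤ c * ρ * (1 - ∑ n, b n) + l1 x →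
          H x ≤ Real.log ((zeta κ ρ c * ρ + ∑ n, optimalShare κ ρ c n / b n * x n) / W) := by
  classical
  obtain ⟨hint, hI1, hzI⟩ := zeta_integral κ ρ c hc hae
  have hsum := mul_sum_optimalShare_add_zeta κ ρ c hc hae
  have hdpos := ae_zeta_mul_add_pos κ ρ c hc hae
  have hx0 : ∀ᵐ x ∂κ, ∀ n, optimalShare κ ρ c n = 0 → x n = 0 := by
    rw [ae_all_iff]
    intro n
    by_cases h : optimalShare κ ρ c n = 0
    · filter_upwards [ae_eq_zero_of_optimalShare_eq_zero κ ρ c n h] with x hx _ using hx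
    · exact Filter.Eventually.of_forall fun x hx => absurd hx h
  set z := zeta κ ρ c
  set l := optimalShare κ ρ c
  set I := ∫ x : Fin N → ℝ≥0, (c * ρ / (z * ρ + l1 x) : ℝ) ∂κ
  have hc' : (0 : ℝ) < c := by exact_mod_cast hc
  -- Jensen needs positive points even where `l n = 0`. The value `1` is harmless, because then `x n
  -- = 0` a.s.
  set u : Fin N → ℝ := fun n => if l n = 0 then 1 else l n / b n with hu
  have hupos : ∀ n, 0 < u n := fun n => by
    by_cases h : l n = 0
    · simp [hu, h]
    · simp only [hu, h, if_false]
      exact div_pos (by exact_mod_cast pos_iff_ne_zero.mpr h) (hb n h)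
  have hu' : ∀ n, (l n : ℝ) ≠ 0 → 0 < b n ∧ u n = l n / b n := fun n hn => by
    have h : l n ≠ 0 := by exact_mod_cast hn
    exact ⟨hb n h, by simp [hu, h]⟩
  have hiA : Integrable (fun x : Fin N → ℝ≥0 =>
      ∑ n, (x n / (z * ρ + l1 x) : ℝ) * Real.log (u n)) κ :=
    integrable_finsetSum _ fun n _ => (integrable_share κ ρ c n).mul_const _
  have hiB := hint.const_mul ((1 - ∑ n, b n) - z / c)
  have hval : ∫ x : Fin N → ℝ≥0, (∑ n, (x n / (z * ρ + l1 x) : ℝ) * Real.log (u n) -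
      ((1 - ∑ n, b n) - z / c) * (c * ρ / (z * ρ + l1 x))) ∂κ =
      ∑ n, l n * Real.log (u n) - ((1 - ∑ n, b n) - z / c) * I := by
    rw [integral_sub hiA hiB, integral_const_mul, integral_finsetSum _
      fun n _ => (integrable_share κ ρ c n).mul_const _]
    congr 1
    refine Finset.sum_congr rfl fun n _ => ?_
    rw [integral_mul_const, ← optimalShare_eq_integral]
  -- Both parts of `zeta_integral` enter: `I ≤ 1` for the nonnegative coefficient `1 - ∑ b n`, and
  -- `z * I = z` for the coefficient of the other sign.
  have hge : ∑ n, ((l n : ℝ) * Real.log (u n) - l n + b n) ≤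
      ∑ n, l n * Real.log (u n) - ((1 - ∑ n, b n) - z / c) * I := by
    rw [Finset.sum_add_distrib, Finset.sum_sub_distrib]
    have h1 : (z : ℝ) / c * I = z / c := by rw [div_mul_eq_mul_div, hzI]
    have h2 : (z : ℝ) / c = 1 - ∑ n, (l n : ℝ) := by
      rw [div_eq_iff hc'.ne']; linarith
    have h3 : (1 - ∑ n, b n) * I ≤ 1 - ∑ n, b n := mul_le_of_le_one_right (by linarith) hI1
    rw [sub_mul, h1, h2]
    linarith
  have hterm : ∀ n, 0 ≤ (l n : ℝ) * Real.log (u n) - l n + b n := fun n =>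
    entropy_nonneg (NNReal.coe_nonneg _) (hb0 n) (hu' n)
  -- The minorant is the Jensen bound for `log s` minus the linear bound for `log (W / d)`.
  refine ⟨_, hiA.sub hiB, ?_, ?_, ?_⟩
  · exact (Finset.sum_nonneg fun n _ => hterm n).trans (hge.trans_eq hval.symm)
  · rintro ⟨n, hn⟩
    refine lt_of_lt_of_le ?_ (hge.trans_eq hval.symm)
    exact Finset.sum_pos' (fun n _ => hterm n)
      ⟨n, Finset.mem_univ n, entropy_pos (NNReal.coe_nonneg _) (hb0 n) (hu' n) hn⟩
  · filter_upwards [hdpos, hx0] with x hd hx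
    have hd' : (0 : ℝ) < z * ρ + l1 x := by exact_mod_cast hd
    set d : ℝ := z * ρ + l1 x with hddef
    have hl1 : ∑ n, (x n : ℝ) = l1 x := by simp [l1]
    have hp : (z * ρ / d : ℝ) + ∑ n, (x n / d : ℝ) = 1 := by
      rw [← Finset.sum_div, hl1, ← add_div, div_self hd'.ne']
    obtain ⟨hspos, hJ⟩ := sum_mul_log_le_log (p₀ := (z * ρ / d : ℝ)) (p := fun n => (x n / d : ℝ))
      (by positivity) (fun n => by positivity) hp hupos
    set s := (z * ρ / d : ℝ) + ∑ n, (x n / d : ℝ) * u n with hs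
    have hsd : (z * ρ + ∑ n, l n / b n * x n : ℝ) = s * d := by
      rw [hs, add_mul, div_mul_cancel₀ _ hd'.ne', Finset.sum_mul]
      congr 1
      refine Finset.sum_congr rfl fun n _ => ?_
      by_cases h : l n = 0
      · simp [h, hx n h]
      · simp only [hu, h, if_false]
        field_simp
    rw [hsd]
    refine ⟨mul_pos hspos hd', fun W hW hWle => ?_⟩
    have h1 : Real.log (s * d / W) = Real.log s - Real.log (W / d) := by
      rw [Real.log_div (by positivity) hW.ne', Real.log_mul hspos.ne' hd'.ne',
        Real.log_div hW.ne' hd'.ne']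
      ring
    have h2 := Real.log_le_sub_one_of_pos (div_pos hW hd')
    have h3 : W / d ≤ (c * ρ * (1 - ∑ n, b n) + l1 x) / d := by gcongr
    have h4 : (c * ρ * (1 - ∑ n, b n) + l1 x) / d - 1 =
        ((1 - ∑ n, b n) - z / c) * (c * ρ / d) := by
      field_simp
      rw [hddef]
      ring
    change ∑ n, (x n / d : ℝ) * Real.log (u n) - ((1 - ∑ n, b n) - z / c) * (c * ρ / d) ≤ _
    rw [h1]
    linarith

end Growth

/-! ### Shares of total wealth held by groups of optimal investors -/

section Coalition

variable {M N : ℕ}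

/-- The share of the coalition `S` in the total wealth after one step of the wealth equation. -/
noncomputable def coalitionShare (S : Finset (Fin M)) (ρ : ℝ≥0) (a : Fin M → Action N)
    (y : Fin M → ℝ≥0) (x : Fin N → ℝ≥0) : ℝ≥0 :=
  (∑ k ∈ S, wealthStep ρ x a y k) / ∑ k, wealthStep ρ x a y k

theorem coe_wealthStep (ρ : ℝ≥0) (a : Fin M → Action N) (y : Fin M → ℝ≥0) (x : Fin N → ℝ≥0)
    (k : Fin M) : (wealthStep ρ x a y k : ℝ) = ρ * (1 - ∑ n, ((a k).1 n : ℝ)) * y k +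
      ∑ n, ((a k).1 n * y k / (∑ j, (a j).1 n * y j) * x n : ℝ) := by
  unfold wealthStep
  push_cast [NNReal.coe_sub (a k).2]
  rfl

/-- Equality can fail, since by `0 / 0 = 0` the payoff of an asset in which nobody invests is lost.
-/
theorem sum_wealthStep_le (ρ : ℝ≥0) (a : Fin M → Action N) (y : Fin M → ℝ≥0) (x : Fin N → ℝ≥0) :
    ((∑ k, wealthStep ρ x a y k : ℝ≥0) : ℝ) ≤
      ρ * (∑ k, (y k : ℝ) - ∑ n, ∑ k, ((a k).1 n * y k : ℝ)) + l1 x := by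
  rw [NNReal.coe_sum, Finset.sum_congr rfl fun k _ => coe_wealthStep ρ a y x k, Finset.sum_add_distrib]
  refine add_le_add (le_of_eq ?_) ?_
  · rw [Finset.sum_comm, ← Finset.sum_sub_distrib, Finset.mul_sum]
    refine Finset.sum_congr rfl fun k _ => ?_
    rw [← Finset.sum_mul]
    ring
  · rw [Finset.sum_comm, l1, NNReal.coe_sum]
    refine Finset.sum_le_sum fun n _ => ?_
    rw [← Finset.sum_mul, ← Finset.sum_div]
    push_cast
    exact mul_le_of_le_one_left (NNReal.coe_nonneg _) (div_self_le_one _)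

theorem sum_coalition_wealthStep (S : Finset (Fin M)) (ρ : ℝ≥0) (a : Fin M → Action N)
    (y : Fin M → ℝ≥0) (x : Fin N → ℝ≥0) (l : Fin N → ℝ≥0) (hS : ∀ k ∈ S, (a k).1 = l) :
    ((∑ k ∈ S, wealthStep ρ x a y k : ℝ≥0) : ℝ) = (∑ k ∈ S, (y k : ℝ)) *
      (ρ * (1 - ∑ n, (l n : ℝ)) + ∑ n, (l n / (∑ j, (a j).1 n * y j) * x n : ℝ)) := by
  rw [NNReal.coe_sum, Finset.sum_mul]
  refine Finset.sum_congr rfl fun k hk => ?_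
  rw [coe_wealthStep, hS k hk, mul_add, Finset.mul_sum]
  congr 1
  · ring
  · refine Finset.sum_congr rfl fun n _ => ?_
    ring

theorem coalitionShare_le_one (S : Finset (Fin M)) (ρ : ℝ≥0) (a : Fin M → Action N)
    (y : Fin M → ℝ≥0) (x : Fin N → ℝ≥0) : coalitionShare S ρ a y x ≤ 1 :=
  div_le_one_of_le₀ (Finset.sum_le_univ_sum_of_nonneg fun _ => zero_le) zero_le

theorem measurable_wealthStep {α : Type*} [MeasurableSpace α] {ρ : α → ℝ≥0}
    {a : α → Fin M → Action N} {y : α → Fin M → ℝ≥0} {x : α → Fin N → ℝ≥0} (hρ : Measurable ρ)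
    (ha : Measurable a) (hy : Measurable y) (hx : Measurable x) (m : Fin M) :
    Measurable fun p => wealthStep (ρ p) (x p) (a p) (y p) m := by
  have ha' : ∀ k n, Measurable fun p => (a p k).1 n := fun k n =>
    (measurable_pi_apply n).comp (measurable_subtype_coe.comp ((measurable_pi_apply k).comp ha))
  unfold wealthStep
  fun_prop

theorem measurable_coalitionShare {α : Type*} [MeasurableSpace α] (S : Finset (Fin M)) {ρ : α → ℝ≥0}
    {a : α → Fin M → Action N} {y : α → Fin M → ℝ≥0} {x : α → Fin N → ℝ≥0} (hρ : Measurable ρ)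
    (ha : Measurable a) (hy : Measurable y) (hx : Measurable x) :
    Measurable fun p => coalitionShare S (ρ p) (a p) (y p) (x p) := by
  have := measurable_wealthStep hρ ha hy hx
  unfold coalitionShare
  fun_prop

variable (κ : Measure (Fin N → ℝ≥0)) [IsProbabilityMeasure κ] (ρ : ℝ≥0) (a : Fin M → Action N)
  (y : Fin M → ℝ≥0) (S : Finset (Fin M))

/-- Members with a common portfolio have a common return, so the group acts as one investor and
`exists_minorant` applies to the average portfolio of the market. The positive capital of the group
makes this average positive wherever the optimal portfolio is. -/
theorem coalition_minorant (hS : ∀ k ∈ S, (a k).1 = optimalShare κ ρ (∑ k, y k))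
    (hq : 0 < ∑ k ∈ S, y k) (hae : ∀ᵐ x ∂κ, 0 < ρ + l1 x) :
    ∃ H : (Fin N → ℝ≥0) → ℝ, Integrable H κ ∧ 0 ≤ ∫ x, H x ∂κ ∧
      ((∃ n, ∑ k, (a k).1 n * y k ≠ optimalShare κ ρ (∑ k, y k) n * ∑ k, y k) →
        0 < ∫ x, H x ∂κ) ∧
      ∀ᵐ x ∂κ, 0 < coalitionShare S ρ a y x ∧
        Real.log ((∑ k ∈ S, y k : ℝ≥0) / (∑ k, y k : ℝ≥0)) + H x ≤
          Real.log (coalitionShare S ρ a y x) := by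
  set c := ∑ k, y k with hcdef
  set l := optimalShare κ ρ c with hl
  have hqc : ∑ k ∈ S, y k ≤ c := Finset.sum_le_univ_sum_of_nonneg fun _ => zero_le
  have hc : 0 < c := hq.trans_le hqc
  have hc' : (0 : ℝ) < c := by exact_mod_cast hc
  have hq' : (0 : ℝ) < (∑ k ∈ S, y k : ℝ≥0) := by exact_mod_cast hq
  have hSle : ∀ n, l n * ∑ k ∈ S, y k ≤ ∑ k, (a k).1 n * y k := fun n => by
    rw [Finset.mul_sum]
    calc ∑ k ∈ S, l n * y k = ∑ k ∈ S, (a k).1 n * y k :=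
          Finset.sum_congr rfl fun k hk => by rw [hS k hk]
      _ ≤ _ := Finset.sum_le_univ_sum_of_nonneg fun _ => zero_le
  have hsumD : ∑ n, ∑ k, (a k).1 n * y k ≤ c := by
    rw [Finset.sum_comm]
    refine Finset.sum_le_sum fun k _ => ?_
    rw [← Finset.sum_mul]
    exact mul_le_of_le_one_left zero_le (a k).2
  have hsumD' : ∑ n, ((∑ k, (a k).1 n * y k : ℝ≥0) : ℝ) ≤ c := by exact_mod_cast hsumD
  obtain ⟨H, hHi, hH0, hHpos, hHle⟩ := exists_minorant κ ρ c hc hae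
    (fun n => ((∑ k, (a k).1 n * y k : ℝ≥0) : ℝ) / c) (fun n => by positivity)
    (by rw [← Finset.sum_div]; exact div_le_one_of_le₀ hsumD' hc'.le)
    (fun n hn => div_pos (by
      have := (mul_pos (pos_iff_ne_zero.mpr hn) hq).trans_le (hSle n)
      exact_mod_cast this) hc')
  refine ⟨H, hHi, hH0, ?_, ?_⟩
  · rintro ⟨n, hn⟩
    refine hHpos ⟨n, fun h => hn ?_⟩
    rw [div_eq_iff hc'.ne'] at h
    exact_mod_cast h
  · filter_upwards [hHle] with x hx
    obtain ⟨hnum, hx⟩ := hx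
    set A : ℝ := zeta κ ρ c * ρ + ∑ n, l n / (((∑ k, (a k).1 n * y k : ℝ≥0) : ℝ) / c) * x n with hA
    have hY : ((∑ k ∈ S, wealthStep ρ x a y k : ℝ≥0) : ℝ) = (∑ k ∈ S, y k : ℝ≥0) / c * A := by
      rw [sum_coalition_wealthStep S ρ a y x l hS, hA]
      have h1 : ((zeta κ ρ c : ℝ≥0) : ℝ) = c * (1 - ∑ n, (l n : ℝ)) := by
        have := mul_sum_optimalShare_add_zeta κ ρ c hc hae
        linarith
      have h2 : ∑ n, (l n / (((∑ k, (a k).1 n * y k : ℝ≥0) : ℝ) / c) * x n : ℝ) =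
          c * ∑ n, (l n / (∑ j, (a j).1 n * y j) * x n : ℝ) := by
        rw [Finset.mul_sum]
        refine Finset.sum_congr rfl fun n _ => ?_
        push_cast
        rw [div_div_eq_mul_div]
        ring
      rw [h1, h2]
      push_cast
      field_simp
    have hYpos : (0 : ℝ) < (∑ k ∈ S, wealthStep ρ x a y k : ℝ≥0) := by
      rw [hY]; exact mul_pos (div_pos hq' hc') hnum
    have hYW : ((∑ k ∈ S, wealthStep ρ x a y k : ℝ≥0) : ℝ) ≤ (∑ k, wealthStep ρ x a y k : ℝ≥0) := by
      exact_mod_cast Finset.sum_le_univ_sum_of_nonneg fun _ => zero_le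
    have hWpos := hYpos.trans_le hYW
    have hshare : (coalitionShare S ρ a y x : ℝ) = ((∑ k ∈ S, y k : ℝ≥0) / c) *
        (A / (∑ k, wealthStep ρ x a y k : ℝ≥0)) := by
      rw [coalitionShare, NNReal.coe_div, hY, mul_div_assoc]
    refine ⟨?_, ?_⟩
    · rw [← NNReal.coe_pos, hshare]
      exact mul_pos (div_pos hq' hc') (div_pos hnum hWpos)
    · rw [hshare, Real.log_mul (div_pos hq' hc').ne' (div_pos hnum hWpos).ne']
      refine (add_le_add_iff_left _).mpr (hx _ hWpos ?_)
      refine (sum_wealthStep_le ρ a y x).trans (le_of_eq ?_)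
      have : ∑ k, (y k : ℝ) = c := by rw [hcdef]; push_cast; rfl
      rw [this, ← Finset.sum_div]
      push_cast
      field_simp

/-- The expected value of `-log` of the share of an optimal coalition does not increase. -/
theorem lintegral_neg_log_coalitionShare_le
    (hS : ∀ k ∈ S, (a k).1 = optimalShare κ ρ (∑ k, y k))
    (hq : 0 < ∑ k ∈ S, y k) (hae : ∀ᵐ x ∂κ, 0 < ρ + l1 x) :
    (∀ᵐ x ∂κ, 0 < coalitionShare S ρ a y x) ∧
    ∫⁻ x, ENNReal.ofReal (-Real.log (coalitionShare S ρ a y x)) ∂κ ≤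
      ENNReal.ofReal (-Real.log ((∑ k ∈ S, y k : ℝ≥0) / (∑ k, y k : ℝ≥0))) := by
  obtain ⟨H, hHi, hH0, -, hH⟩ := coalition_minorant κ ρ a y S hS hq hae
  refine ⟨hH.mono fun x hx => hx.1, ?_⟩
  set q : ℝ := (∑ k ∈ S, y k : ℝ≥0) / (∑ k, y k : ℝ≥0)
  have hle : ∀ᵐ x ∂κ, -Real.log (coalitionShare S ρ a y x) ≤ -Real.log q - H x :=
    hH.mono fun x hx => by linarith [hx.2]
  have hnn : ∀ᵐ x ∂κ, 0 ≤ -Real.log q - H x := hle.mono fun x hx => by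
    refine le_trans ?_ hx
    rw [Left.nonneg_neg_iff]
    exact Real.log_nonpos (NNReal.coe_nonneg _) (by exact_mod_cast coalitionShare_le_one S ρ a y x)
  calc _ ≤ ∫⁻ x, ENNReal.ofReal (-Real.log q - H x) ∂κ :=
        lintegral_mono_ae (hle.mono fun x hx => ENNReal.ofReal_le_ofReal hx)
    _ = ENNReal.ofReal (∫ x, (-Real.log q - H x) ∂κ) :=
        (ofReal_integral_eq_lintegral_ofReal ((integrable_const _).sub hHi) hnn).symm
    _ ≤ _ := by
        refine ENNReal.ofReal_le_ofReal ?_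
        rw [integral_sub (integrable_const _) hHi]
        simpa using hH0

/-- The expected share of an optimal coalition strictly increases, unless the whole market invests
optimally on average. -/
theorem lintegral_one_sub_coalitionShare_lt
    (hS : ∀ k ∈ S, (a k).1 = optimalShare κ ρ (∑ k, y k))
    (hq : 0 < ∑ k ∈ S, y k) (hae : ∀ᵐ x ∂κ, 0 < ρ + l1 x)
    (hne : ∃ n, ∑ k, (a k).1 n * y k ≠ optimalShare κ ρ (∑ k, y k) n * ∑ k, y k) :
    ∫⁻ x, ENNReal.ofReal (1 - coalitionShare S ρ a y x) ∂κ <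
      ENNReal.ofReal (1 - (∑ k ∈ S, y k : ℝ≥0) / (∑ k, y k : ℝ≥0)) := by
  obtain ⟨H, hHi, -, hHpos, hH⟩ := coalition_minorant κ ρ a y S hS hq hae
  have hHpos := hHpos hne
  have hqc : ∑ k ∈ S, y k ≤ ∑ k, y k := Finset.sum_le_univ_sum_of_nonneg fun _ => zero_le
  have hc := hq.trans_le hqc
  set q : ℝ := (∑ k ∈ S, y k : ℝ≥0) / (∑ k, y k : ℝ≥0)
  have hq0 : 0 < q := div_pos (by exact_mod_cast hq) (by exact_mod_cast hc)
  have hle : ∀ᵐ x ∂κ, 1 - (coalitionShare S ρ a y x : ℝ) ≤ 1 - q - q * H x := by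
    filter_upwards [hH] with x hx
    have h0 : (0 : ℝ) < coalitionShare S ρ a y x := by exact_mod_cast hx.1
    have h1 := Real.log_le_sub_one_of_pos (div_pos h0 hq0)
    rw [Real.log_div h0.ne' hq0.ne'] at h1
    -- From logarithms to shares: `log v ≤ v - 1` with `v` the ratio of new to old share gives new
    -- share at least `q * (1 + H x)`.
    have h2 : q * H x ≤ q * (coalitionShare S ρ a y x / q - 1) :=
      mul_le_mul_of_nonneg_left (by linarith [hx.2]) hq0.le
    rw [mul_sub, mul_div_cancel₀ _ hq0.ne'] at h2
    linarith
  have hnn : ∀ᵐ x ∂κ, 0 ≤ 1 - q - q * H x := hle.mono fun x hx => by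
    refine le_trans ?_ hx
    rw [sub_nonneg]
    exact_mod_cast coalitionShare_le_one S ρ a y x
  have hint : Integrable (fun x => 1 - q - q * H x) κ := (integrable_const _).sub (hHi.const_mul q)
  have hval : ∫ x, (1 - q - q * H x) ∂κ = 1 - q - q * ∫ x, H x ∂κ := by
    rw [integral_sub (integrable_const _) (hHi.const_mul q), integral_const_mul]
    simp
  have hpos : 0 < q * ∫ x, H x ∂κ := mul_pos hq0 hHpos
  -- With `hpos` this yields `q < 1`, without which the strict inequality would be lost under
  -- `ENNReal.ofReal`.
  have h0 : 0 ≤ 1 - q - q * ∫ x, H x ∂κ := hval ▸ integral_nonneg_of_ae hnn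
  calc _ ≤ ∫⁻ x, ENNReal.ofReal (1 - q - q * H x) ∂κ :=
        lintegral_mono_ae (hle.mono fun x hx => ENNReal.ofReal_le_ofReal hx)
    _ = ENNReal.ofReal (∫ x, (1 - q - q * H x) ∂κ) :=
        (ofReal_integral_eq_lintegral_ofReal hint hnn).symm
    _ < _ := by
        rw [hval]
        exact (ENNReal.ofReal_lt_ofReal_iff (by linarith)).mpr (by linarith)

end Coalition

/-! ### Integration against regular conditional distributions -/

section Disintegration

/-- The joint law of `(T, X)` and the composition product agree on rectangles, hence everywhere. The
map `T` is later the identity onto the same set with a smaller σ-algebra. -/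
theorem lintegral_eq_lintegral_kernel {Ω Ω' E : Type*} [MeasurableSpace Ω] [MeasurableSpace Ω']
    [MeasurableSpace E] {μ : Measure Ω} [IsFiniteMeasure μ] {T : Ω → Ω'} (hT : Measurable T)
    {X : Ω → E} (hX : Measurable X) (K : Kernel Ω' E) [IsMarkovKernel K]
    (hK : ∀ s A, MeasurableSet s → MeasurableSet A →
      μ (T ⁻¹' s ∩ X ⁻¹' A) = ∫⁻ ω in T ⁻¹' s, K (T ω) A ∂μ)
    {Φ : Ω' × E → ℝ≥0∞} (hΦ : Measurable Φ) :
    ∫⁻ ω, Φ (T ω, X ω) ∂μ = ∫⁻ ω, ∫⁻ x, Φ (T ω, x) ∂(K (T ω)) ∂μ := by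
  have hmap : μ.map (fun ω => (T ω, X ω)) = (μ.map T) ⊗ₘ K := by
    rw [Measure.ext_prod_iff]
    intro s A hs hA
    rw [Measure.map_apply (hT.prodMk hX) (hs.prod hA), Measure.compProd_apply_prod hs hA,
      setLIntegral_map hs (K.measurable_coe hA) hT, ← hK s A hs hA]
    rfl
  have h1 := lintegral_map (μ := μ) hΦ (hT.prodMk hX)
  rw [← h1, hmap, Measure.lintegral_compProd hΦ, lintegral_map ?_ hT]
  exact hΦ.lintegral_kernel_prod_right'

/-- Integration against a regular conditional distribution. -/
theorem setLIntegral_eq_of_condDistrib {Ω E : Type*} {mF m0 : MeasurableSpace Ω}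
    [MeasurableSpace E] {μ : Measure Ω} [IsProbabilityMeasure μ] (hm : mF ≤ m0)
    {X : Ω → E} (hX : Measurable X) (K : @Kernel Ω E mF _) [IsMarkovKernel K]
    (hK : ∀ A, MeasurableSet A → (fun ω => (K ω).real A) =ᵐ[μ] μ⟦X ⁻¹' A | mF⟧)
    {Φ : Ω × E → ℝ≥0∞} (hΦ : Measurable[mF.prod inferInstance] Φ)
    {s : Set Ω} (hs : MeasurableSet[mF] s) :
    ∫⁻ ω in s, Φ (ω, X ω) ∂μ = ∫⁻ ω in s, ∫⁻ x, Φ (ω, x) ∂(K ω) ∂μ := by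
  refine @lintegral_eq_lintegral_kernel Ω Ω E m0 mF _ (μ.restrict s) _ id
    (measurable_id'' hm) X hX K _ ?_ Φ hΦ
  intro t A ht hA
  simp only [Set.preimage_id, id]
  have hts : MeasurableSet[mF] (t ∩ s) := ht.inter hs
  have hXA : MeasurableSet (X ⁻¹' A) := hX hA
  have hmeas : Measurable fun ω => K ω A := (K.measurable_coe hA).mono hm le_rfl
  rw [Measure.restrict_restrict (hm _ ht), Measure.restrict_apply ((hm _ ht).inter hXA)]
  have h1 : ∫ ω in t ∩ s, (K ω).real A ∂μ =
      ∫ ω in t ∩ s, (X ⁻¹' A).indicator (fun _ => (1 : ℝ)) ω ∂μ := by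
    rw [← setIntegral_condExp hm ((integrable_const (1 : ℝ)).indicator hXA) hts]
    exact setIntegral_congr_ae (hm _ hts) ((hK A hA).mono fun ω hω _ => hω)
  rw [integral_indicator hXA, Measure.restrict_restrict hXA, setIntegral_const, smul_eq_mul, mul_one,
    integral_eq_lintegral_of_nonneg_ae (Filter.Eventually.of_forall fun _ => measureReal_nonneg)
      hmeas.ennreal_toReal.aestronglyMeasurable, measureReal_def] at h1
  have h2 : ∀ ω, ENNReal.ofReal ((K ω).real A) = K ω A := fun ω => by simp
  simp only [h2] at h1
  rw [ENNReal.toReal_eq_toReal_iff' ?_ (measure_ne_top _ _)] at h1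
  · rw [h1]
    congr 1
    ext ω
    simp only [Set.mem_inter_iff]
    tauto
  · refine ne_top_of_le_ne_top (measure_ne_top μ (t ∩ s)) ?_
    calc _ ≤ ∫⁻ _ in t ∩ s, 1 ∂μ := lintegral_mono fun ω => prob_le_one
      _ = _ := by simp

/-- A property holds a.s. for `X` if and only if it does a.s. under the regular conditional
distribution. -/
theorem ae_iff_ae_kernel {Ω E : Type*} {mF m0 : MeasurableSpace Ω}
    [MeasurableSpace E] {μ : Measure Ω} [IsProbabilityMeasure μ] (hm : mF ≤ m0)
    {X : Ω → E} (hX : Measurable X) (K : @Kernel Ω E mF _) [IsMarkovKernel K]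
    (hK : ∀ A, MeasurableSet A → (fun ω => (K ω).real A) =ᵐ[μ] μ⟦X ⁻¹' A | mF⟧)
    {B : Set (Ω × E)} (hB : MeasurableSet[mF.prod inferInstance] B) :
    (∀ᵐ ω ∂μ, (ω, X ω) ∈ B) ↔ ∀ᵐ ω ∂μ, ∀ᵐ x ∂(K ω), (ω, x) ∈ B := by
  have hB' : Measurable[mF.prod inferInstance] (Bᶜ.indicator (fun _ => (1 : ℝ≥0∞))) :=
    (@measurable_const _ _ _ (mF.prod inferInstance) 1).indicator hB.compl
  have h := setLIntegral_eq_of_condDistrib hm hX K hK hB' MeasurableSet.univ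
  have hin : Measurable fun ω => ∫⁻ x, Bᶜ.indicator (fun _ => (1 : ℝ≥0∞)) (ω, x) ∂(K ω) :=
    Measurable.mono (@Measurable.lintegral_kernel_prod_right' Ω E mF _ K _ _ hB') hm le_rfl
  have hpair : Measurable[m0, mF.prod inferInstance] fun ω => (ω, X ω) :=
    @Measurable.prodMk _ m0 _ _ mF _ _ _ (measurable_id'' hm) hX
  rw [setLIntegral_univ, setLIntegral_univ] at h
  have h1 : (∀ᵐ ω ∂μ, (ω, X ω) ∈ B) ↔
      ∫⁻ ω, Bᶜ.indicator (fun _ => (1 : ℝ≥0∞)) (ω, X ω) ∂μ = 0 := by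
    have hcomp : Measurable fun ω => Bᶜ.indicator (fun _ => (1 : ℝ≥0∞)) (ω, X ω) := hB'.comp hpair
    rw [lintegral_eq_zero_iff hcomp]
    refine Filter.eventually_congr (Filter.Eventually.of_forall fun ω => ?_)
    simp
  rw [h1, h, lintegral_eq_zero_iff hin]
  refine Filter.eventually_congr (Filter.Eventually.of_forall fun ω => ?_)
  have hsec : Measurable fun x => Bᶜ.indicator (fun _ => (1 : ℝ≥0∞)) (ω, x) :=
    hB'.comp (@measurable_prodMk_left _ _ mF _ ω)
  rw [Pi.zero_apply, lintegral_eq_zero_iff hsec]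
  refine Filter.eventually_congr (Filter.Eventually.of_forall fun x => ?_)
  simp

end Disintegration

/-! ### Measurability of histories and wealth -/

section Market

/-- The map `f` covers two cases: the identity, for adaptedness of wealth, and the projection from
pairs of a state and a history, for measurability of the optimal rule. -/
theorem measurable_wealthOf {α Ω : Type*} [MeasurableSpace α] {M N : ℕ} {X : ℕ → Ω → Fin N → ℝ≥0}
    {ρ : ℕ → Ω → ℝ≥0} {f : α → Ω} {y : α → Fin M → ℝ≥0} (hy : Measurable y) :
    ∀ (t : ℕ) {h : α → Actions M N t}, Measurable h →
      (∀ s < t, Measurable fun p => X (s + 1) (f p)) →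
      (∀ s < t, Measurable fun p => ρ (s + 1) (f p)) →
      Measurable fun p => wealthOf X ρ (f p) (y p) t (h p)
  | 0, _, _, _, _ => hy
  | t + 1, h, hh, hX, hρ => by
    have hinit : Measurable fun p => (Fin.init (h p) : Actions M N t) :=
      measurable_pi_lambda _ fun i => (measurable_pi_apply i.castSucc).comp hh
    have ih := measurable_wealthOf hy t hinit (fun s hs => hX s (hs.trans t.lt_succ_self))
      (fun s hs => hρ s (hs.trans t.lt_succ_self))
    exact measurable_pi_lambda _ fun m => measurable_wealthStep (hρ t t.lt_succ_self)
      ((measurable_pi_apply (Fin.last t)).comp hh) ih (hX t t.lt_succ_self) m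

variable {Ω : Type*} {m0 : MeasurableSpace Ω} {ℱ : Filtration ℕ m0} {M N : ℕ}
  {X : ℕ → Ω → Fin N → ℝ≥0} {ρ : ℕ → Ω → ℝ≥0}

theorem isStrategy_optimalRule (hX : ∀ t : ℕ, Measurable[ℱ (t + 1)] (X (t + 1)))
    (hρ : ∀ t : ℕ, Measurable[ℱ t] (ρ (t + 1)))
    (K : (t : ℕ) → @Kernel Ω (Fin N → ℝ≥0) (ℱ t) _) [∀ t, IsMarkovKernel (K t)] :
    IsStrategy ℱ (optimalRule X ρ ℱ K : Rule Ω M N) := by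
  intro t
  let _ : MeasurableSpace (Ω × ((Fin M → ℝ≥0) × Actions M N t)) := (ℱ t).prod inferInstance
  have hfst : Measurable[_, ℱ t] (Prod.fst : Ω × ((Fin M → ℝ≥0) × Actions M N t) → Ω) :=
    @measurable_fst _ _ (ℱ t) _
  have hsnd : Measurable (Prod.snd : Ω × ((Fin M → ℝ≥0) × Actions M N t) → _) :=
    @measurable_snd _ _ (ℱ t) _
  have hW : Measurable fun p : Ω × ((Fin M → ℝ≥0) × Actions M N t) =>
      totalWealthOf X ρ p.1 p.2.1 t p.2.2 := by
    refine Finset.measurable_fun_sum _ fun m _ => (measurable_pi_apply m).comp ?_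
    refine measurable_wealthOf (measurable_fst.comp hsnd) t (measurable_snd.comp hsnd) ?_ ?_
    · exact fun s hs => ((hX s).mono (ℱ.mono hs) le_rfl).comp hfst
    · exact fun s hs => ((hρ s).mono (ℱ.mono hs.le) le_rfl).comp hfst
  refine Measurable.subtype_mk (measurable_pi_lambda _ fun n => ?_)
  exact measurable_optimalShare (Kernel.comap (K t) Prod.fst hfst)
    ((hρ t).comp hfst) hW n

variable {L : Fin M → Rule Ω M N} {y₀ : Fin M → ℝ≥0}

theorem measurable_apply_history {t : ℕ}
    (hh : Measurable[ℱ t] fun ω => history L y₀ ω t) {Λ : Rule Ω M N} (hΛ : IsStrategy ℱ Λ) :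
    Measurable[ℱ t] fun ω => Λ t ω y₀ (history L y₀ ω t) :=
  (hΛ t).comp (@Measurable.prodMk _ (ℱ t) _ _ (ℱ t) _ _ _ measurable_id
    (measurable_const.prodMk hh))

theorem measurable_history (hL : ∀ k, IsStrategy ℱ (L k)) :
    ∀ t, Measurable[ℱ t] fun ω => history L y₀ ω t
  | 0 => (@measurable_pi_iff _ _ _ (ℱ 0) _ _).mpr fun i => i.elim0
  | t + 1 => by
    have ih := measurable_history hL t
    refine Measurable.mono ?_ (ℱ.mono t.le_succ) le_rfl
    refine (@measurable_pi_iff _ _ _ (ℱ t) _ _).mpr fun i => ?_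
    refine Fin.lastCases ?_ (fun i => ?_) i
    · simp only [history, Fin.snoc_last]
      exact (@measurable_pi_iff _ _ _ (ℱ t) _ _).mpr fun k => measurable_apply_history ih (hL k)
    · simp only [history, Fin.snoc_castSucc]
      exact (measurable_pi_apply i).comp ih

theorem measurable_realization (hL : ∀ k, IsStrategy ℱ (L k)) (t : ℕ) :
    Measurable[ℱ t] fun ω k => realization L y₀ k t ω :=
  (@measurable_pi_iff _ _ _ (ℱ t) _ _).mpr fun k =>
    measurable_apply_history (measurable_history hL t) (hL k)

theorem measurable_wealth (hX : ∀ t : ℕ, Measurable[ℱ (t + 1)] (X (t + 1)))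
    (hρ : ∀ t : ℕ, Measurable[ℱ t] (ρ (t + 1))) (hL : ∀ k, IsStrategy ℱ (L k)) (t : ℕ) :
    Measurable[ℱ t] fun ω k => wealth X ρ L y₀ k t ω :=
  @measurable_wealthOf Ω Ω (ℱ t) M N X ρ id _ measurable_const t _ (measurable_history hL t)
    (fun s hs => (hX s).mono (ℱ.mono hs) le_rfl) (fun s hs => (hρ s).mono (ℱ.mono hs.le) le_rfl)

theorem wealth_succ (t : ℕ) (ω : Ω) (m : Fin M) : wealth X ρ L y₀ m (t + 1) ω =
    wealthStep (ρ (t + 1) ω) (X (t + 1) ω) (fun k => realization L y₀ k t ω)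
      (fun k => wealth X ρ L y₀ k t ω) m := by
  simp only [wealth, history, wealthOf, Fin.snoc_last, Fin.init_snoc]
  rfl

theorem relWealth_succ (t : ℕ) (ω : Ω) (m : Fin M) : relWealth X ρ L y₀ m (t + 1) ω =
    coalitionShare {m} (ρ (t + 1) ω) (fun k => realization L y₀ k t ω)
      (fun k => wealth X ρ L y₀ k t ω) (X (t + 1) ω) := by
  simp only [relWealth, wealth_succ, coalitionShare, Finset.sum_singleton]
  push_cast
  rfl

theorem measurable_relWealth (hX : ∀ t : ℕ, Measurable[ℱ (t + 1)] (X (t + 1)))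
    (hρ : ∀ t : ℕ, Measurable[ℱ t] (ρ (t + 1))) (hL : ∀ k, IsStrategy ℱ (L k)) (m : Fin M)
    (t : ℕ) : Measurable[ℱ t] (relWealth X ρ L y₀ m t) := by
  have h : ∀ k, Measurable[ℱ t] fun ω => wealth X ρ L y₀ k t ω := fun k =>
    (measurable_pi_apply k).comp (measurable_wealth hX hρ hL t)
  exact Measurable.div (h m).coe_nnreal_real
    (Finset.measurable_fun_sum _ fun k _ => (h k).coe_nnreal_real)

theorem relWealth_nonneg (m : Fin M) (t : ℕ) (ω : Ω) : 0 ≤ relWealth X ρ L y₀ m t ω := by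
  unfold relWealth; positivity

theorem relWealth_le_one (m : Fin M) (t : ℕ) (ω : Ω) : relWealth X ρ L y₀ m t ω ≤ 1 :=
  div_le_one_of_le₀ (Finset.single_le_sum (f := fun k => (wealth X ρ L y₀ k t ω : ℝ))
    (fun _ _ => NNReal.coe_nonneg _) (Finset.mem_univ m))
    (Finset.sum_nonneg fun _ _ => NNReal.coe_nonneg _)

theorem measurable_coalitionShare_step (hX : ∀ t : ℕ, Measurable[ℱ (t + 1)] (X (t + 1)))
    (hρ : ∀ t : ℕ, Measurable[ℱ t] (ρ (t + 1))) (hL : ∀ k, IsStrategy ℱ (L k))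
    (S : Finset (Fin M)) (t : ℕ) : Measurable[(ℱ t).prod inferInstance]
      fun p : Ω × (Fin N → ℝ≥0) => coalitionShare S (ρ (t + 1) p.1)
        (fun k => realization L y₀ k t p.1) (fun k => wealth X ρ L y₀ k t p.1) p.2 := by
  have hfst : Measurable[(ℱ t).prod inferInstance, ℱ t] (Prod.fst : Ω × (Fin N → ℝ≥0) → Ω) :=
    @measurable_fst _ _ (ℱ t) _
  exact @measurable_coalitionShare _ _ _ ((ℱ t).prod inferInstance) S _ _ _ _
    ((hρ t).comp hfst) ((measurable_realization hL t).comp hfst)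
    ((measurable_wealth hX hρ hL t).comp hfst) (@measurable_snd _ _ (ℱ t) _)

end Market

/-! ### The optimal rule is relative growth optimal -/

section Optimality

variable {Ω : Type*} {m0 : MeasurableSpace Ω} {μ : Measure Ω} [IsProbabilityMeasure μ]
  {ℱ : Filtration ℕ m0} {M N : ℕ} {X : ℕ → Ω → Fin N → ℝ≥0} {ρ : ℕ → Ω → ℝ≥0}
  {K : (t : ℕ) → @Kernel Ω (Fin N → ℝ≥0) (ℱ t) _} [∀ t, IsMarkovKernel (K t)]
  {L : Fin M → Rule Ω M N} {y₀ : Fin M → ℝ≥0} {m : Fin M}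

theorem ae_kernel_add_l1_pos (hX : ∀ t : ℕ, Measurable[ℱ (t + 1)] (X (t + 1)))
    (hρ : ∀ t : ℕ, Measurable[ℱ t] (ρ (t + 1)))
    (hpos : ∀ t : ℕ, ∀ᵐ ω ∂μ, 0 < ρ (t + 1) ω + ∑ n, X (t + 1) ω n)
    (hK : IsRegularCondDistrib X μ ℱ K) (t : ℕ) :
    ∀ᵐ ω ∂μ, ∀ᵐ x ∂(K t ω), 0 < ρ (t + 1) ω + l1 x := by
  have hmeas : Measurable[(ℱ t).prod inferInstance]
      fun p : Ω × (Fin N → ℝ≥0) => ρ (t + 1) p.1 + l1 p.2 :=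
    ((hρ t).comp (@measurable_fst _ _ (ℱ t) _)).add
      (measurable_l1.comp (@measurable_snd _ _ (ℱ t) _))
  exact (ae_iff_ae_kernel (ℱ.le t) ((hX t).mono (ℱ.le _) le_rfl) (K t) (hK t)
    (hmeas measurableSet_Ioi)).mp (hpos t)

theorem wealth_pos_of_relWealth_pos {t : ℕ} {ω : Ω} (h : 0 < relWealth X ρ L y₀ m t ω) :
    0 < wealth X ρ L y₀ m t ω := by
  rw [pos_iff_ne_zero]
  intro h0
  simp [relWealth, h0] at h

/-- Agreement at the single time `t` is enough, which covers opponents who use the optimal rule only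
then. -/
theorem realization_eq_optimalShare {k : Fin M} {t : ℕ} (h : L k t = optimalRule X ρ ℱ K t)
    (ω : Ω) : (realization L y₀ k t ω).1 =
      optimalShare (K t ω) (ρ (t + 1) ω) (∑ j, wealth X ρ L y₀ j t ω) := by
  rw [realization, h]
  rfl

theorem ae_relWealth_pos (hX : ∀ t : ℕ, Measurable[ℱ (t + 1)] (X (t + 1)))
    (hρ : ∀ t : ℕ, Measurable[ℱ t] (ρ (t + 1)))
    (hpos : ∀ t : ℕ, ∀ᵐ ω ∂μ, 0 < ρ (t + 1) ω + ∑ n, X (t + 1) ω n)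
    (hK : IsRegularCondDistrib X μ ℱ K) (hL : ∀ k, IsStrategy ℱ (L k))
    (hm : L m = optimalRule X ρ ℱ K) (hy : ∀ k, 0 < y₀ k) :
    ∀ t, ∀ᵐ ω ∂μ, 0 < relWealth X ρ L y₀ m t ω
  | 0 => by
    refine Filter.Eventually.of_forall fun ω => div_pos (by exact_mod_cast hy m) ?_
    exact Finset.sum_pos (fun k _ => by exact_mod_cast hy k) ⟨m, Finset.mem_univ m⟩
  | t + 1 => by
    have hB : MeasurableSet[(ℱ t).prod inferInstance] {p : Ω × (Fin N → ℝ≥0) |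
        0 < coalitionShare {m} (ρ (t + 1) p.1) (fun k => realization L y₀ k t p.1)
          (fun k => wealth X ρ L y₀ k t p.1) p.2} :=
      measurable_coalitionShare_step hX hρ hL {m} t measurableSet_Ioi
    have key := (ae_iff_ae_kernel (μ := μ) (ℱ.le t) ((hX t).mono (ℱ.le _) le_rfl) (K t) (hK t)
      hB).mpr (by
        filter_upwards [ae_relWealth_pos hX hρ hpos hK hL hm hy t,
          ae_kernel_add_l1_pos hX hρ hpos hK t] with ω hω hae
        exact (lintegral_neg_log_coalitionShare_le (K t ω) (ρ (t + 1) ω)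
          (fun k => realization L y₀ k t ω) (fun k => wealth X ρ L y₀ k t ω) {m}
          (fun k hk => realization_eq_optimalShare (by rw [Finset.mem_singleton.mp hk, hm]) ω)
          (by simpa using wealth_pos_of_relWealth_pos hω) hae).1)
    filter_upwards [key] with ω hω
    rw [relWealth_succ, NNReal.coe_pos]
    exact hω

theorem setLIntegral_neg_log_relWealth_le (hX : ∀ t : ℕ, Measurable[ℱ (t + 1)] (X (t + 1)))
    (hρ : ∀ t : ℕ, Measurable[ℱ t] (ρ (t + 1)))
    (hpos : ∀ t : ℕ, ∀ᵐ ω ∂μ, 0 < ρ (t + 1) ω + ∑ n, X (t + 1) ω n)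
    (hK : IsRegularCondDistrib X μ ℱ K) (hL : ∀ k, IsStrategy ℱ (L k))
    (hm : L m = optimalRule X ρ ℱ K) (hy : ∀ k, 0 < y₀ k) (t : ℕ) {s : Set Ω}
    (hs : MeasurableSet[ℱ t] s) :
    ∫⁻ ω in s, ENNReal.ofReal (-Real.log (relWealth X ρ L y₀ m (t + 1) ω)) ∂μ ≤
      ∫⁻ ω in s, ENNReal.ofReal (-Real.log (relWealth X ρ L y₀ m t ω)) ∂μ := by
  have hΦ : Measurable[(ℱ t).prod inferInstance] fun p : Ω × (Fin N → ℝ≥0) =>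
      ENNReal.ofReal (-Real.log (coalitionShare {m} (ρ (t + 1) p.1)
        (fun k => realization L y₀ k t p.1) (fun k => wealth X ρ L y₀ k t p.1) p.2)) :=
    (measurable_coalitionShare_step hX hρ hL {m} t).coe_nnreal_real.log.neg.ennreal_ofReal
  simp only [relWealth_succ]
  rw [setLIntegral_eq_of_condDistrib (ℱ.le t) ((hX t).mono (ℱ.le _) le_rfl) (K t) (hK t) hΦ hs]
  refine lintegral_mono_ae (ae_restrict_of_ae ?_)
  filter_upwards [ae_relWealth_pos hX hρ hpos hK hL hm hy t,
    ae_kernel_add_l1_pos hX hρ hpos hK t] with ω hω hae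
  refine (lintegral_neg_log_coalitionShare_le (K t ω) (ρ (t + 1) ω)
    (fun k => realization L y₀ k t ω) (fun k => wealth X ρ L y₀ k t ω) {m}
    (fun k hk => realization_eq_optimalShare (by rw [Finset.mem_singleton.mp hk, hm]) ω)
    (by simpa using wealth_pos_of_relWealth_pos hω) hae).2.trans (le_of_eq ?_)
  rw [Finset.sum_singleton, relWealth]
  push_cast
  rfl

/-- As `-log r` is nonnegative, the one-step inequality for `lintegral` presupposes no integrability
and yields it by induction, starting from a constant at time `0`. -/
theorem submartingale_log_relWealth (hX : ∀ t : ℕ, Measurable[ℱ (t + 1)] (X (t + 1)))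
    (hρ : ∀ t : ℕ, Measurable[ℱ t] (ρ (t + 1)))
    (hpos : ∀ t : ℕ, ∀ᵐ ω ∂μ, 0 < ρ (t + 1) ω + ∑ n, X (t + 1) ω n)
    (hK : IsRegularCondDistrib X μ ℱ K) (hL : ∀ k, IsStrategy ℱ (L k))
    (hm : L m = optimalRule X ρ ℱ K) (hy : ∀ k, 0 < y₀ k) :
    Submartingale (fun t ω => Real.log (relWealth X ρ L y₀ m t ω)) ℱ μ := by
  have hmeas : ∀ t, Measurable[ℱ t] fun ω => Real.log (relWealth X ρ L y₀ m t ω) := fun t =>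
    (measurable_relWealth hX hρ hL m t).log
  have hmeas' : ∀ t, Measurable fun ω => Real.log (relWealth X ρ L y₀ m t ω) := fun t =>
    (hmeas t).mono (ℱ.le t) le_rfl
  have hnn : ∀ t ω, 0 ≤ -Real.log (relWealth X ρ L y₀ m t ω) := fun t ω => by
    rw [Left.nonneg_neg_iff]
    exact Real.log_nonpos (relWealth_nonneg m t ω) (relWealth_le_one m t ω)
  have hstep := fun t (s : Set Ω) (hs : MeasurableSet[ℱ t] s) =>
    setLIntegral_neg_log_relWealth_le hX hρ hpos hK hL hm hy t hs
  have hfin : ∀ t, ∫⁻ ω, ENNReal.ofReal (-Real.log (relWealth X ρ L y₀ m t ω)) ∂μ < ∞ := by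
    intro t
    induction t with
    | zero =>
      simp only [relWealth, wealth, wealthOf]
      simp
    | succ t ih =>
      have := hstep t Set.univ MeasurableSet.univ
      rw [setLIntegral_univ, setLIntegral_univ] at this
      exact this.trans_lt ih
  have hint : ∀ t, Integrable (fun ω => -Real.log (relWealth X ρ L y₀ m t ω)) μ := fun t =>
    ⟨(hmeas' t).neg.aestronglyMeasurable, by
      rw [hasFiniteIntegral_iff_ofReal (Filter.Eventually.of_forall (hnn t))]
      exact hfin t⟩
  refine submartingale_of_setIntegral_le_succ (fun t => (hmeas t).stronglyMeasurable)
    (fun t => by simpa using (hint t).neg) fun t s hs => ?_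
  have hval : ∀ t, ∫ ω in s, Real.log (relWealth X ρ L y₀ m t ω) ∂μ =
      -(∫⁻ ω in s, ENNReal.ofReal (-Real.log (relWealth X ρ L y₀ m t ω)) ∂μ).toReal := fun t => by
    rw [← integral_eq_lintegral_of_nonneg_ae (Filter.Eventually.of_forall (hnn t))
      (hmeas' t).neg.aestronglyMeasurable, integral_neg, neg_neg]
  rw [hval, hval, neg_le_neg_iff]
  exact ENNReal.toReal_mono ((setLIntegral_le_lintegral _ _).trans_lt (hfin t)).ne (hstep t s hs)

theorem isRelativeGrowthOptimal_optimalRule (hX : ∀ t : ℕ, Measurable[ℱ (t + 1)] (X (t + 1)))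
    (hρ : ∀ t : ℕ, Measurable[ℱ t] (ρ (t + 1)))
    (hpos : ∀ t : ℕ, ∀ᵐ ω ∂μ, 0 < ρ (t + 1) ω + ∑ n, X (t + 1) ω n)
    (hK : IsRegularCondDistrib X μ ℱ K) (m : Fin M) :
    IsRelativeGrowthOptimal X ρ μ ℱ m (optimalRule X ρ ℱ K) := by
  intro y₀ hy L hL
  have hL' : ∀ k, IsStrategy ℱ (Function.update L m (optimalRule X ρ ℱ K) k) := fun k => by
    by_cases h : k = m
    · subst h; simpa using isStrategy_optimalRule hX hρ K
    · simpa [h] using hL k h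
  exact ⟨ae_relWealth_pos hX hρ hpos hK hL' (by simp) hy,
    submartingale_log_relWealth hX hρ hpos hK hL' (by simp) hy⟩

end Optimality

/-! ### Uniqueness up to the time when the investor owns the whole market -/

section Uniqueness

variable {Ω : Type*} {m0 : MeasurableSpace Ω} {μ : Measure Ω} [IsProbabilityMeasure μ]
  {ℱ : Filtration ℕ m0} {M N : ℕ} {X : ℕ → Ω → Fin N → ℝ≥0} {ρ : ℕ → Ω → ℝ≥0}
  {K : (t : ℕ) → @Kernel Ω (Fin N → ℝ≥0) (ℱ t) _} [∀ t, IsMarkovKernel (K t)]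
  {L : Fin M → Rule Ω M N} {y₀ : Fin M → ℝ≥0} {m : Fin M}

theorem coalitionShare_singleton_le (m : Fin M) (r : ℝ≥0) (a : Fin M → Action N)
    (y : Fin M → ℝ≥0) (x : Fin N → ℝ≥0) :
    (coalitionShare {m} r a y x : ℝ) ≤ 1 - coalitionShare {m}ᶜ r a y x := by
  have h : coalitionShare {m} r a y x + coalitionShare {m}ᶜ r a y x ≤ 1 := by
    rw [coalitionShare, coalitionShare, ← add_div, Finset.sum_singleton,
      ← Fintype.sum_eq_add_sum_compl m]
    exact div_self_le_one _
  have h' : (coalitionShare {m} r a y x : ℝ) + coalitionShare {m}ᶜ r a y x ≤ 1 := by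
    exact_mod_cast h
  linarith

theorem relWealth_eq_one_sub {t : ℕ} {ω : Ω} (h : 0 < ∑ k, wealth X ρ L y₀ k t ω) :
    relWealth X ρ L y₀ m t ω = 1 - ((∑ k ∈ {m}ᶜ, wealth X ρ L y₀ k t ω : ℝ≥0) : ℝ) /
      (∑ k, wealth X ρ L y₀ k t ω : ℝ≥0) := by
  have h' : (0 : ℝ) < (∑ k, wealth X ρ L y₀ k t ω : ℝ≥0) := by exact_mod_cast h
  have hs : ((∑ k, wealth X ρ L y₀ k t ω : ℝ≥0) : ℝ) = wealth X ρ L y₀ m t ω +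
      (∑ k ∈ {m}ᶜ, wealth X ρ L y₀ k t ω : ℝ≥0) := by
    exact_mod_cast Fintype.sum_eq_add_sum_compl m _
  rw [relWealth, ← NNReal.coe_sum, eq_sub_iff_add_eq, ← add_div, ← hs, div_self h'.ne']

/-- If all others invest optimally at time `t`, then an investor whose relative wealth is a
submartingale must do so as well, unless she owns everything or nothing. -/
theorem ae_realization_eq_of_submartingale (hX : ∀ t : ℕ, Measurable[ℱ (t + 1)] (X (t + 1)))
    (hρ : ∀ t : ℕ, Measurable[ℱ t] (ρ (t + 1)))
    (hpos : ∀ t : ℕ, ∀ᵐ ω ∂μ, 0 < ρ (t + 1) ω + ∑ n, X (t + 1) ω n)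
    (hK : IsRegularCondDistrib X μ ℱ K) (hL : ∀ k, IsStrategy ℱ (L k)) {t : ℕ}
    (hopt : ∀ k, k ≠ m → L k t = optimalRule X ρ ℱ K t)
    (hsub : Submartingale (relWealth X ρ L y₀ m) ℱ μ) :
    ∀ᵐ ω ∂μ, 0 < wealth X ρ L y₀ m t ω → 0 < ∑ k ∈ {m}ᶜ, wealth X ρ L y₀ k t ω →
      L m t ω y₀ (history L y₀ ω t) = optimalRule X ρ ℱ K t ω y₀ (history L y₀ ω t) := by
  have hwm := measurable_wealth (y₀ := y₀) hX hρ hL t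
  have hw : ∀ k, Measurable[ℱ t] fun ω => wealth X ρ L y₀ k t ω := fun k =>
    (measurable_pi_apply k).comp hwm
  have hact : ∀ {Λ : Rule Ω M N}, IsStrategy ℱ Λ →
      Measurable[ℱ t] fun ω => (Λ t ω y₀ (history L y₀ ω t)).1 := fun hΛ =>
    measurable_subtype_coe.comp (measurable_apply_history (measurable_history hL t) hΛ)
  -- The exceptional event belongs to `ℱ t`; if it had positive measure, the expected relative
  -- wealth of `m` on it would strictly decrease.
  set A : Set Ω := {ω | 0 < wealth X ρ L y₀ m t ω} ∩
    {ω | 0 < ∑ k ∈ {m}ᶜ, wealth X ρ L y₀ k t ω} ∩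
    {ω | (L m t ω y₀ (history L y₀ ω t)).1 =
      (optimalRule X ρ ℱ K t ω y₀ (history L y₀ ω t)).1}ᶜ with hA
  have hAm : MeasurableSet[ℱ t] A := by
    refine (MeasurableSet.inter (hw m measurableSet_Ioi) ?_).inter (MeasurableSet.compl ?_)
    · exact (Finset.measurable_fun_sum _ fun k _ => hw k) measurableSet_Ioi
    · exact @measurableSet_eq_fun _ _ (ℱ t) _ _ _ _ (hact (hL m))
        (hact (isStrategy_optimalRule hX hρ K))
  have hA0 : μ A = 0 := by
    by_contra hne
    have hr : ∀ t, Measurable (relWealth X ρ L y₀ m t) := fun t =>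
      (measurable_relWealth hX hρ hL m t).mono (ℱ.le t) le_rfl
    have hofReal : ∀ t, ∫⁻ ω in A, ENNReal.ofReal (relWealth X ρ L y₀ m t ω) ∂μ =
        ENNReal.ofReal (∫ ω in A, relWealth X ρ L y₀ m t ω ∂μ) := fun t =>
      (ofReal_integral_eq_lintegral_ofReal (hsub.integrable t).integrableOn
        (Filter.Eventually.of_forall (relWealth_nonneg m t))).symm
    have hle : ∫⁻ ω in A, ENNReal.ofReal (relWealth X ρ L y₀ m t ω) ∂μ ≤
        ∫⁻ ω in A, ENNReal.ofReal (relWealth X ρ L y₀ m (t + 1) ω) ∂μ := by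
      rw [hofReal, hofReal]
      exact ENNReal.ofReal_le_ofReal (hsub.setIntegral_le t.le_succ hAm)
    have hfin : ∫⁻ ω in A, ENNReal.ofReal (relWealth X ρ L y₀ m (t + 1) ω) ∂μ ≠ ∞ := by
      rw [hofReal]; exact ENNReal.ofReal_ne_top
    have hΦ := (measurable_coalitionShare_step (y₀ := y₀) hX hρ hL {m}
      t).coe_nnreal_real.ennreal_ofReal
    simp only [relWealth_succ] at hle hfin
    rw [setLIntegral_eq_of_condDistrib (ℱ.le t) ((hX t).mono (ℱ.le _) le_rfl) (K t) (hK t) hΦ hAm]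
      at hle hfin
    refine absurd hle (not_le.mpr ?_)
    refine setLIntegral_strict_mono (ℱ.le t _ hAm) hne (hr t).ennreal_ofReal hfin ?_
    filter_upwards [ae_kernel_add_l1_pos hX hρ hpos hK t] with ω hae hωA
    obtain ⟨⟨hωm, hωo⟩, hωne⟩ := hωA
    have hcpos : 0 < ∑ k, wealth X ρ L y₀ k t ω := by
      rw [Fintype.sum_eq_add_sum_compl m]; exact add_pos_of_pos_of_nonneg hωm zero_le
    have hS : ∀ k ∈ ({m}ᶜ : Finset (Fin M)), (realization L y₀ k t ω).1 =
        optimalShare (K t ω) (ρ (t + 1) ω) (∑ k, wealth X ρ L y₀ k t ω) := fun k hk => by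
      have hkm : k ≠ m := by simpa using hk
      exact realization_eq_optimalShare (hopt k hkm) ω
    rw [relWealth_eq_one_sub hcpos]
    -- Only `≤` holds here: both shares are `0` if total wealth vanishes at the next step.
    refine lt_of_le_of_lt (lintegral_mono fun x =>
      ENNReal.ofReal_le_ofReal (coalitionShare_singleton_le m _ _ _ x)) ?_
    refine lintegral_one_sub_coalitionShare_lt (K t ω) _ (fun k => realization L y₀ k t ω)
      (fun k => wealth X ρ L y₀ k t ω) {m}ᶜ hS hωo hae ?_
    -- If the market invests optimally on average and the others do so individually, subtracting
    -- their part and cancelling the positive wealth of `m` shows that `m` does too.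
    by_contra! hall
    refine hωne (funext fun n => ?_)
    have hn := hall n
    rw [Finset.mul_sum, Fintype.sum_eq_add_sum_compl m, Fintype.sum_eq_add_sum_compl m,
      Finset.sum_congr rfl fun k hk => by rw [hS k hk]] at hn
    exact mul_right_cancel₀ hωm.ne' (add_right_cancel hn)
  filter_upwards [measure_eq_zero_iff_ae_notMem.mp hA0] with ω hω h1 h2
  by_contra hne
  exact hω ⟨⟨h1, h2⟩, fun h => hne (Subtype.ext h)⟩

theorem history_eq_of_forall_lt {L' : Fin M → Rule Ω M N} {ω : Ω} :
    ∀ {t : ℕ}, (∀ s < t, ∀ k, L k s = L' k s) → history L y₀ ω t = history L' y₀ ω t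
  | 0, _ => rfl
  | t + 1, h => by
    have ih : history L y₀ ω t = history L' y₀ ω t :=
      history_eq_of_forall_lt fun s hs => h s (hs.trans t.lt_succ_self)
    simp only [history, ih, h t t.lt_succ_self]

/-- The others use the same functions of the history in both markets, so the histories can separate
only through a decision of `m`. That decision is tested against opponents for whom it must be
optimal. -/
theorem ae_history_eq (hX : ∀ t : ℕ, Measurable[ℱ (t + 1)] (X (t + 1)))
    (hρ : ∀ t : ℕ, Measurable[ℱ t] (ρ (t + 1)))
    (hpos : ∀ t : ℕ, ∀ᵐ ω ∂μ, 0 < ρ (t + 1) ω + ∑ n, X (t + 1) ω n)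
    (hK : IsRegularCondDistrib X μ ℱ K) {Λ : Rule Ω M N} (hΛ : IsStrategy ℱ Λ)
    (hsub : RelWealthSubmartingale X ρ μ ℱ m Λ) (hy : ∀ k, 0 < y₀ k)
    (hL : ∀ k, k ≠ m → IsStrategy ℱ (L k)) :
    ∀ t, ∀ᵐ ω ∂μ, (∀ s < t, relWealth X ρ (Function.update L m Λ) y₀ m s ω ≠ 1) →
      history (Function.update L m (optimalRule X ρ ℱ K)) y₀ ω t =
        history (Function.update L m Λ) y₀ ω t
  | 0 => Filter.Eventually.of_forall fun _ _ => rfl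
  | t + 1 => by
    have hopt := isStrategy_optimalRule (M := M) hX hρ K
    -- the market in which all others switch to the optimal rule at time `t`
    set L' : Fin M → Rule Ω M N := fun k s => if s = t then optimalRule X ρ ℱ K s else L k s
      with hL'def
    have hL' : ∀ k, k ≠ m → IsStrategy ℱ (L' k) := fun k hk s => by
      by_cases hs : s = t
      · simpa [hL'def, hs] using hopt s
      · simpa [hL'def, hs] using hL k hk s
    have hL'all : ∀ k, IsStrategy ℱ (Function.update L' m Λ k) := fun k => by
      by_cases h : k = m
      · subst h; simpa using hΛ
      · simpa [h] using hL' k h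
    have hhist : ∀ ω, history (Function.update L' m Λ) y₀ ω t =
        history (Function.update L m Λ) y₀ ω t := fun ω =>
      history_eq_of_forall_lt fun s hs k => by
        by_cases h : k = m
        · subst h; simp
        · simp [h, hL'def, hs.ne]
    have hwealth : ∀ k ω, wealth X ρ (Function.update L' m Λ) y₀ k t ω =
        wealth X ρ (Function.update L m Λ) y₀ k t ω := fun k ω => by
      rw [wealth, hhist, wealth]
    filter_upwards [ae_history_eq hX hρ hpos hK hΛ hsub hy hL t,
      (isRelativeGrowthOptimal_optimalRule hX hρ hpos hK m y₀ hy L hL).1 t,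
      ae_realization_eq_of_submartingale hX hρ hpos hK hL'all (t := t)
        (fun k hk => by simp [hk, hL'def]) (hsub y₀ hy L' hL')] with ω ih hrpos heq hne
    have ih := ih fun s hs => hne s (hs.trans t.lt_succ_self)
    have hr1 := hne t t.lt_succ_self
    simp only [hwealth, hhist, Function.update_self] at heq
    -- Positivity is known in the market with the optimal rule and is transferred along the equal
    -- histories; nothing of the kind is assumed about `Λ`.
    have hrpos' : 0 < relWealth X ρ (Function.update L m Λ) y₀ m t ω := by
      simpa only [relWealth, wealth, ih] using hrpos
    have hwpos := wealth_pos_of_relWealth_pos hrpos'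
    -- If the others owned nothing, the relative wealth of `m` would be `1`, which is excluded
    -- before the hitting time.
    have hopos : 0 < ∑ k ∈ {m}ᶜ, wealth X ρ (Function.update L m Λ) y₀ k t ω := by
      rw [pos_iff_ne_zero]
      intro h0
      refine hr1 ?_
      rw [relWealth_eq_one_sub, h0]
      · simp
      · rw [Fintype.sum_eq_add_sum_compl m]
        exact add_pos_of_pos_of_nonneg hwpos zero_le
    have heq := heq hwpos hopos
    simp only [history, ih]
    congr 1
    funext k
    by_cases h : k = m
    · subst h; simpa using heq.symm
    · simp [h]

theorem equalInRealizationUntil_hitOne (hX : ∀ t : ℕ, Measurable[ℱ (t + 1)] (X (t + 1)))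
    (hρ : ∀ t : ℕ, Measurable[ℱ t] (ρ (t + 1)))
    (hpos : ∀ t : ℕ, ∀ᵐ ω ∂μ, 0 < ρ (t + 1) ω + ∑ n, X (t + 1) ω n)
    (hK : IsRegularCondDistrib X μ ℱ K) {Λ : Rule Ω M N} (hΛ : IsStrategy ℱ Λ)
    (hsub : RelWealthSubmartingale X ρ μ ℱ m Λ) :
    EqualInRealizationUntil μ ℱ m (optimalRule X ρ ℱ K) Λ (hitOne X ρ m) := by
  intro y₀ hy L hL
  filter_upwards [ae_all_iff.mpr (ae_history_eq hX hρ hpos hK hΛ hsub hy hL)] with ω hω t ht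
  -- The bound `t + 1 ≤ τ` excludes relative wealth `1` at all times up to `t`; only the hitting
  -- time in the market with `Λ` is needed.
  have h := hω (t + 1) fun s hs h1 => by
    have hle : hitOne X ρ m y₀ (Function.update L m Λ) ω ≤ s := iInf₂_le s h1
    have := (ht.trans (min_le_right _ _)).trans hle
    exact absurd (Nat.cast_le.mp this) (not_le.mpr hs)
  have h' := congrFun (congrFun h (Fin.last t)) m
  simpa only [history, Fin.snoc_last, realization] using h'

end Uniqueness

end AssetMarketGame

theorem theorem1 {Ω : Type*} {m0 : MeasurableSpace Ω} (μ : Measure Ω) [IsProbabilityMeasure μ]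
    (ℱ : Filtration ℕ m0) (M N : ℕ) (hM : 2 ≤ M) (hN : 1 ≤ N)
    (X : ℕ → Ω → Fin N → ℝ≥0) (ρ : ℕ → Ω → ℝ≥0)
    (hX : ∀ t : ℕ, Measurable[ℱ (t + 1)] (X (t + 1)))
    (hρ : ∀ t : ℕ, Measurable[ℱ t] (ρ (t + 1)))
    (hpos : ∀ t : ℕ, ∀ᵐ ω ∂μ, 0 < ρ (t + 1) ω + ∑ n, X (t + 1) ω n)
    (K : (t : ℕ) → @Kernel Ω (Fin N → ℝ≥0) (ℱ t) _) [∀ t, IsMarkovKernel (K t)]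
    (hK : IsRegularCondDistrib X μ ℱ K) (m : Fin M) :
    IsStrategy ℱ (optimalRule X ρ ℱ K : Rule Ω M N) ∧
    IsRelativeGrowthOptimal X ρ μ ℱ m (optimalRule X ρ ℱ K) ∧
    ∀ Λ : Rule Ω M N, IsStrategy ℱ Λ → RelWealthSubmartingale X ρ μ ℱ m Λ →
      EqualInRealizationUntil μ ℱ m (optimalRule X ρ ℱ K) Λ (hitOne X ρ m) :=
  ⟨isStrategy_optimalRule hX hρ K, isRelativeGrowthOptimal_optimalRule hX hρ hpos hK m,
    fun _ hΛ hsub => equalInRealizationUntil_hitOne hX hρ hpos hK hΛ hsub⟩
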